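/- Let $X\in\mathbb R^{n\times p}$, $H=X(X^TX)^{+}X^T$ (Moore--Penrose inverse), $y\in\mathbb R^n$, $\nu\ge 0$, and let $q\ge0$ be an integer. The quantile-thresholding operator $\Theta^{\#}(s;q,\nu)$ divides the $q$ entries of $s\in\mathbb R^n$ that are largest in absolute value by $1+\nu$ and sets the others to $0$ (ties may be broken arbitrarily). Consider the algorithm $$\gamma^{(t+1)}=\Theta^{\#}(y-X\beta^{(t)};q,\nu),\qquad \beta^{(t+1)}=(X^TX)^{+}X^T(y-\gamma^{(t+1)})\qquad(t\ge 0)$$ started from any $\beta^{(0)}\in\mathbb R^p$, or its one-line form $\gamma^{(t+1)}=\Theta^{\#}(H\gamma^{(t)}+(I-H)y;q,\nu)$, $t\ge1$, started from any $\gamma^{(1)}\in\mathbb R^n$, with $\beta^{(t)}=(X^TX)^{+}X^T(y-\gamma^{(t)})$ for $t\ge 1$. Below, $C,c,K>0$ are numerical constants, $\|\cdot\|_0$ counts nonzero entries, and $0\log(en/0):=0$. (a) If the algorithm is started from $\beta^{(0)}$, or from $\gamma^{(1)}$ with $\|\gamma^{(1)}\|_0\le q$, then for every $T\ge1$ $$\min_{1\le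 t\le T}\|X(\beta^{(t)}-\beta^{(t+1)})\|_2^2=\min_{1\le t\le T}\|H(\gamma^{(t)}-\gamma^{(t+1)})\|_2^2\le\frac1T\Big(\|(I-H)(\gamma^{(1)}-y)\|_2^2+\nu\|\gamma^{(1)}\|_2^2\Big).$$ (b) Let $n>p$ and $y=X\beta^*+\gamma^*+\epsilon$ with $\|\gamma^*\|_0=o^*$, where $\epsilon$ is a mean-zero sub-Gaussian random vector with scale bounded by $\sigma$, that is, $\|\langle\epsilon,\alpha\rangle\|_{\psi_2}\le\sigma\|\alpha\|_2$ for all $\alpha\in\mathbb R^n$, where $\|\xi\|_{\psi_2}=\inf\{s>0:\mathbb E\exp(\xi^2/s^2)\le2\}$. Let $q=\vartheta o^*$ with $\vartheta>1$, and suppose that for some $0<\varepsilon<1$ $$\|H\Delta\|_2^2\le(1-\varepsilon)\|\Delta\|_2^2\quad\text{for all }\Delta\text{ with }\|\Delta\|_0\le(1+\vartheta)o^*.$$ Put $\kappa=\{\varepsilon-1/\sqrt\vartheta+(1-1/\sqrt\vartheta)\nu\}/(1-\varepsilon)$ and suppose $\kappa>0$. Then, with probability at least $1-C(n-p)^{-c}$,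 for every starting point (which may depend on the data) and all $t\ge1$, $$\|H(\gamma^{(t)}-\gamma^*)\|_2^2\le K\Big\{\Big(\frac1{1+\kappa}\Big)^{t-1}\|H(\gamma^{(1)}-\gamma^*)\|_2^2+\frac{\nu}{\kappa}\|\gamma^*\|_2^2+\frac{\sigma^2}{\kappa}\vartheta o^*\log\frac{en}{o^*}\Big\}.$$ If instead the $\epsilon_i$ are independent mean-zero sub-Gaussian random variables with $\|\epsilon_i\|_{\psi_2}\le\sigma$, then, with probability at least $1-C(n-p)^{-c}-C\exp(-cp)$, for every starting point and all $t\ge1$, $$\|X(\beta^{(t)}-\beta^*)\|_2^2\le K\Big\{\Big(\frac1{1+\kappa}\Big)^{t-1}\|X(\beta^{(1)}-\beta^*)\|_2^2+\frac{\nu}{\kappa}\|\gamma^*\|_2^2+p\sigma^2+\frac{\sigma^2}{\kappa}\vartheta o^*\log\frac{en}{o^*}\Big\}.$$ -/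

import Mathlib

open Matrix MeasureTheory

noncomputable section

/-- Squared Euclidean norm of a real vector. -/
def l2Sq {n : ℕ} (v : Fin n → ℝ) : ℝ := ∑ i, v i ^ 2

/-- The four Penrose equations: `G` is the Moore-Penrose inverse of the square matrix `A`. -/
structure IsMoorePenroseInverse {p : ℕ} (A G : Matrix (Fin p) (Fin p) ℝ) : Prop where
  mul_mul_self : A * G * A = A
  self_mul_mul : G * A * G = G
  symm_left : (A * G)ᵀ = A * G
  symm_right : (G * A)ᵀ = G * A

/-- The Gram matrix is symmetric. -/
theorem gram_isHermitian {n p : ℕ} (X : Matrix (Fin n) (Fin p) ℝ) : (Xᵀ * X).IsHermitian := by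
  simp [Matrix.IsHermitian, Matrix.conjTranspose_eq_transpose_of_trivial]

/-- The Moore-Penrose inverse of the Gram matrix `Xᵀ X`: in an orthonormal eigenbasis, nonzero
eigenvalues are inverted and zero eigenvalues are kept (recall `(0 : ℝ)⁻¹ = 0`). -/
def gramPinv {n p : ℕ} (X : Matrix (Fin n) (Fin p) ℝ) : Matrix (Fin p) (Fin p) ℝ :=
  ((gram_isHermitian X).eigenvectorUnitary : Matrix (Fin p) (Fin p) ℝ) *
    Matrix.diagonal (fun i => ((gram_isHermitian X).eigenvalues i)⁻¹) *
    ((gram_isHermitian X).eigenvectorUnitary : Matrix (Fin p) (Fin p) ℝ)ᵀ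

/-- `gramPinv X` is the Moore-Penrose inverse of `Xᵀ X`. -/
theorem gramPinv_isMoorePenroseInverse {n p : ℕ} (X : Matrix (Fin n) (Fin p) ℝ) :
    IsMoorePenroseInverse (Xᵀ * X) (gramPinv X) := by
  set hA := gram_isHermitian X with hAdef
  set U : Matrix (Fin p) (Fin p) ℝ := (hA.eigenvectorUnitary : Matrix (Fin p) (Fin p) ℝ) with hU
  have hUU : Uᵀ * U = 1 := by
    have h := Unitary.coe_star_mul_self hA.eigenvectorUnitary
    rwa [Matrix.star_eq_conjTranspose, Matrix.conjTranspose_eq_transpose_of_trivial] at h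
  have hs : Xᵀ * X = U * Matrix.diagonal hA.eigenvalues * Uᵀ := by
    have h := hA.spectral_theorem
    rw [Unitary.conjStarAlgAut_apply] at h
    rwa [Matrix.star_eq_conjTranspose, Matrix.conjTranspose_eq_transpose_of_trivial] at h
  have hg : gramPinv X = U * Matrix.diagonal (fun i => (hA.eigenvalues i)⁻¹) * Uᵀ := rfl
  have key : ∀ d e : Fin p → ℝ, (U * Matrix.diagonal d * Uᵀ) * (U * Matrix.diagonal e * Uᵀ)
      = U * Matrix.diagonal (fun i => d i * e i) * Uᵀ := by
    intro d e
    calc _ = U * Matrix.diagonal d * (Uᵀ * U) * Matrix.diagonal e * Uᵀ := by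
          simp only [Matrix.mul_assoc]
      _ = _ := by
          rw [hUU, Matrix.mul_one, Matrix.mul_assoc U, Matrix.diagonal_mul_diagonal]
  have symm : ∀ d : Fin p → ℝ, (U * Matrix.diagonal d * Uᵀ)ᵀ = U * Matrix.diagonal d * Uᵀ := by
    intro d
    simp [Matrix.transpose_mul, Matrix.mul_assoc]
  rw [hs, hg]
  refine ⟨?_, ?_, ?_, ?_⟩
  · rw [key, key]
    congr 3
    funext i
    exact mul_inv_mul_cancel (hA.eigenvalues i)
  · rw [key, key]
    congr 3
    funext i
    simpa only [inv_inv] using mul_inv_mul_cancel (hA.eigenvalues i)⁻¹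
  · rw [key, symm]
  · rw [key, symm]

/-- The hat matrix `H = X (Xᵀ X)⁺ Xᵀ`. -/
def hatMatrix {n p : ℕ} (X : Matrix (Fin n) (Fin p) ℝ) : Matrix (Fin n) (Fin n) ℝ :=
  X * gramPinv X * Xᵀ

/-- `t = Θ^#(s; q, ν)`: with the entries of `s` listed in nonincreasing order of absolute value
(the permutation `π` is such a listing), the first `q` entries are divided by `1 + ν` and all the
others are set to zero. When ties make several listings possible, each result is admitted. -/
def IsQuantileThreshold {n : ℕ} (s : Fin n → ℝ) (q : ℕ) (ν : ℝ) (t : Fin n → ℝ) : Prop :=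
  ∃ π : Equiv.Perm (Fin n), Antitone (fun j => |s (π j)|) ∧
    ∀ j, t (π j) = if (j : ℕ) < q then s (π j) / (1 + ν) else 0

/-- The least-squares step `(Xᵀ X)⁺ Xᵀ (y - γ)`. -/
def lsStep {n p : ℕ} (X : Matrix (Fin n) (Fin p) ℝ) (y γ : Fin n → ℝ) : Fin p → ℝ :=
  gramPinv X *ᵥ (Xᵀ *ᵥ (y - γ))

/-- Block coordinate descent, started from an arbitrary `β 0`: for `t ≥ 0`,
`γ (t+1) = Θ^#(y - X β(t); q, ν)` and `β (t+1) = (Xᵀ X)⁺ Xᵀ (y - γ (t+1))`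
(the value `γ 0` plays no role). -/
def IsBCDRun {n p : ℕ} (X : Matrix (Fin n) (Fin p) ℝ) (y : Fin n → ℝ) (q : ℕ) (ν : ℝ)
    (β : ℕ → Fin p → ℝ) (γ : ℕ → Fin n → ℝ) : Prop :=
  ∀ t : ℕ, IsQuantileThreshold (y - X *ᵥ β t) q ν (γ (t + 1)) ∧
    β (t + 1) = lsStep X y (γ (t + 1))

/-- The one-line form, started from an arbitrary `γ 1`: for `t ≥ 1`,
`γ (t+1) = Θ^#(H γ(t) + (I - H) y; q, ν)`, with the coefficient iterates
`β t = (Xᵀ X)⁺ Xᵀ (y - γ t)` (the values `γ 0` and `β 0` play no role). -/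
def IsOneLineRun {n p : ℕ} (X : Matrix (Fin n) (Fin p) ℝ) (y : Fin n → ℝ) (q : ℕ) (ν : ℝ)
    (β : ℕ → Fin p → ℝ) (γ : ℕ → Fin n → ℝ) : Prop :=
  ∀ t : ℕ, 1 ≤ t →
    IsQuantileThreshold (hatMatrix X *ᵥ γ t + (1 - hatMatrix X) *ᵥ y) q ν (γ (t + 1)) ∧
    β t = lsStep X y (γ t)

/-- The scale (`ψ₂`-norm) `inf {s > 0 : E exp(ξ² / s²) ≤ 2}`, equal to `⊤` if there is no
such `s`. -/
def psi2Norm {Ω : Type*} [MeasurableSpace Ω] (P : Measure Ω) (ξ : Ω → ℝ) : ENNReal :=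
  sInf (ENNReal.ofReal ''
    {s : ℝ | 0 < s ∧ ∫⁻ ω, ENNReal.ofReal (Real.exp (ξ ω ^ 2 / s ^ 2)) ∂P ≤ 2})

/-- Centered sub-Gaussian random variable: mean zero and Gaussian tails. -/
structure IsSubGaussianVar {Ω : Type*} [MeasurableSpace Ω] (P : Measure Ω) (ξ : Ω → ℝ) :
    Prop where
  integrable : Integrable ξ P
  mean_zero : ∫ ω, ξ ω ∂P = 0
  tail : ∃ C c : ℝ, 0 < C ∧ 0 < c ∧
    ∀ t : ℝ, 0 < t → P.real {ω | t ≤ |ξ ω|} ≤ C * Real.exp (-c * t ^ 2)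

/-- Sub-Gaussian random vector with mean zero and scale bounded by `σ`: every one-dimensional
marginal `⟨ξ, α⟩` is centered sub-Gaussian with `ψ₂`-norm at most `σ ‖α‖₂`. -/
def IsSubGaussianVec {Ω : Type*} [MeasurableSpace Ω] (P : Measure Ω) {n : ℕ}
    (ξ : Ω → Fin n → ℝ) (σ : ℝ) : Prop :=
  ∀ α : Fin n → ℝ, IsSubGaussianVar P (fun ω => ξ ω ⬝ᵥ α) ∧
    psi2Norm P (fun ω => ξ ω ⬝ᵥ α) ≤ ENNReal.ofReal (σ * √(l2Sq α))

/-- Independent centered sub-Gaussian coordinates, each with `ψ₂`-norm at most `σ`. -/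
def IsIndepSubGaussian {Ω : Type*} [MeasurableSpace Ω] (P : Measure Ω) {n : ℕ}
    (ξ : Ω → Fin n → ℝ) (σ : ℝ) : Prop :=
  ProbabilityTheory.iIndepFun (fun i ω => ξ ω i) P ∧
    ∀ i, IsSubGaussianVar P (fun ω => ξ ω i) ∧ psi2Norm P (fun ω => ξ ω i) ≤ ENNReal.ofReal σ

/-- The restricted isometry property of the hat matrix, over vectors with at most `m` nonzero
entries (`m` real). -/
def HatRIP {n p : ℕ} (X : Matrix (Fin n) (Fin p) ℝ) (ε m : ℝ) : Prop :=
  ∀ Δ : Fin n → ℝ, (hammingNorm Δ : ℝ) ≤ m → l2Sq (hatMatrix X *ᵥ Δ) ≤ (1 - ε) * l2Sq Δ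

/-- The rate parameter `κ = {ε - 1/√ϑ + (1 - 1/√ϑ) ν} / (1 - ε)`. -/
def rateKappa (ε ϑ ν : ℝ) : ℝ := (ε - 1 / √ϑ + (1 - 1 / √ϑ) * ν) / (1 - ε)

end

/-!
The one-line iteration majorizes and minimizes: with `s = H γ(t) + (I - H) y`, the threshold
`γ(t+1)` minimizes `‖s - γ‖² + ν ‖γ‖²` over `q`-sparse `γ`. Pythagoras for the orthogonal projection
`H` turns the comparison with `γ = γ(t)` into a decrease of `‖(I - H)(γ - y)‖² + ν ‖γ‖²` by at least
`‖H (γ(t) - γ(t+1))‖²` (`IsOneLineRun.descent`), and telescoping gives the sublinear rate. Block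
coordinate descent runs are one-line runs (`IsBCDRun.isOneLineRun`).

For the statistical error, compare instead with `γ*`, whose sparsity `o` is `q / ϑ`. The entries
that the threshold keeps outside the support of `γ*` dominate the ones it drops inside, which yields
the additional gain `(1 + ν)(1 - 1/√ϑ) ‖γ(t+1) - γ*‖²` (`IsQuantileThreshold.l2Sq_le`). With
`Δ = γ(t) - γ*` and `Δ' = γ(t+1) - γ*`, the comparison becomes
`‖(I - H) Δ'‖² + (1 + ν)(1 - 1/√ϑ) ‖Δ'‖² ≤ ‖H Δ‖² + 2 ⟨noise, (I - H) Δ'⟩ + ν ‖γ*‖²`. The isometry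
property bounds the second term on the left below by `(1 + κ) ‖H Δ'‖²`, and the first one absorbs
the noise, up to the supremum over sparse `Δ'` of `2 ⟨noise, (I - H) Δ'⟩ - ‖(I - H) Δ'‖²`
(`IsOneLineRun.contraction`). The recursion then sums to a geometric decay.

This supremum is at most the largest squared norm of the projection of the noise to the range of
`m` columns of `I - H`, with `m = min (o + q) n`. Both noise models have moment generating function
at most `exp (σ² ‖α‖²)`; integrating it against a standard Gaussian vector bounds the exponential
moment of the squared projection by `2 ^ m` (`HasMgfBound.lintegral_exp_sum_sq_le`). Markov's
inequality and a union over the `C(n, m) ≤ (en/m)^m` supports give the level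
`24 σ² m log (en/m) ≤ 48 σ² ϑ o log (en/o)` outside an event of probability at most `1/n`
(`HasMgfBound.exists_event_sparse`). The same tail bound on the range of `X` controls the projected
noise `H ε`, by which the error of the coefficients differs from that of the outliers.
-/

/-! ### Moment generating functions of sub-Gaussian vectors -/

theorem exp_le_add_exp_sq (x : ℝ) : Real.exp x ≤ x + Real.exp (x ^ 2) := by
  have h1 := Real.add_one_le_exp (x ^ 2)
  rcases le_or_gt |x| 1 with h | h
  · have := abs_le.1 (Real.abs_exp_sub_one_sub_id_le h)
    linarith
  · rcases lt_abs.1 h with h | h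
    · have : Real.exp x ≤ Real.exp (x ^ 2) := Real.exp_le_exp.2 (by nlinarith)
      linarith
    · have : Real.exp x ≤ 1 := Real.exp_le_one_iff.2 (by linarith)
      nlinarith

/-- Convexity of `exp` between `0` and `x`. -/
theorem exp_mul_le_convex (θ x : ℝ) (h0 : 0 ≤ θ) (h1 : θ ≤ 1) :
    Real.exp (θ * x) ≤ 1 - θ + θ * Real.exp x := by
  have := convexOn_exp.2 (Set.mem_univ (0 : ℝ)) (Set.mem_univ x) (sub_nonneg.2 h1) h0 (by ring)
  simpa using this

section
variable {Ω : Type*} [MeasurableSpace Ω] {P : Measure Ω} [IsProbabilityMeasure P]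

/-- For a centered variable, a `ψ₂`-scale `s` bounds the exponential moment by `exp s²`, with no
numerical constant in the exponent. -/
theorem lintegral_exp_le_of_exp_sq {ξ : Ω → ℝ} (hm : Measurable ξ) (hi : Integrable ξ P)
    (h0 : ∫ ω, ξ ω ∂P = 0) {s : ℝ} (hs : 0 < s)
    (h : ∫⁻ ω, ENNReal.ofReal (Real.exp (ξ ω ^ 2 / s ^ 2)) ∂P ≤ 2) :
    ∫⁻ ω, ENNReal.ofReal (Real.exp (ξ ω)) ∂P ≤ ENNReal.ofReal (Real.exp (s ^ 2)) := by
  set W : Ω → ℝ := fun ω => Real.exp (ξ ω ^ 2 / s ^ 2) with hW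
  have hW0 : ∀ ω, 0 ≤ W ω := fun ω => (Real.exp_pos _).le
  have hWm : Measurable W := by fun_prop
  have hWi : Integrable W P :=
    (lintegral_ofReal_ne_top_iff_integrable hWm.aestronglyMeasurable (ae_of_all _ hW0)).1
      (ne_top_of_le_ne_top (by simp) h)
  have hW2 : ∫ ω, W ω ∂P ≤ 2 := by
    rw [integral_eq_lintegral_of_nonneg_ae (ae_of_all _ hW0) hWm.aestronglyMeasurable]
    exact ENNReal.toReal_le_of_le_ofReal (by norm_num) (by simpa using h)
  -- it suffices to dominate `exp ξ` pointwise by an affine function of `ξ` and `W`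
  have key : ∀ a b d : ℝ, 0 ≤ d → (∀ ω, Real.exp (ξ ω) ≤ a + b * ξ ω + d * W ω) →
      a + d * 2 ≤ Real.exp (s ^ 2) →
      ∫⁻ ω, ENNReal.ofReal (Real.exp (ξ ω)) ∂P ≤ ENNReal.ofReal (Real.exp (s ^ 2)) := by
    intro a b d hd hp hc
    have hint : Integrable (fun ω => a + b * ξ ω + d * W ω) P :=
      ((integrable_const a).add (hi.const_mul b)).add (hWi.const_mul d)
    calc ∫⁻ ω, ENNReal.ofReal (Real.exp (ξ ω)) ∂P
        ≤ ∫⁻ ω, ENNReal.ofReal (a + b * ξ ω + d * W ω) ∂P :=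
          lintegral_mono fun ω => ENNReal.ofReal_le_ofReal (hp ω)
      _ = ENNReal.ofReal (∫ ω, (a + b * ξ ω + d * W ω) ∂P) :=
          (ofReal_integral_eq_lintegral_ofReal hint
            (ae_of_all _ fun ω => (Real.exp_pos _).le.trans (hp ω))).symm
      _ ≤ _ := by
          apply ENNReal.ofReal_le_ofReal
          have e1 : ∫ ω, (a + b * ξ ω + d * W ω) ∂P = a + d * ∫ ω, W ω ∂P := by
            have e2 : Integrable (fun ω => a + b * ξ ω) P :=
              (integrable_const a).add (hi.const_mul b)
            rw [integral_add e2 (hWi.const_mul d),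
              integral_add (integrable_const a) (hi.const_mul b), integral_const_mul,
              integral_const_mul, h0]
            simp
          rw [e1]
          nlinarith
  rcases le_or_gt s 1 with h1 | h1
  · -- small scale: `exp x ≤ x + exp (x²)` and Jensen's inequality for the power `s² ≤ 1`
    have hs2 : s ^ 2 ≤ 1 := pow_le_one₀ hs.le h1
    refine key (1 - s ^ 2) 1 (s ^ 2) (sq_nonneg s) (fun ω => ?_) ?_
    · have e1 := exp_le_add_exp_sq (ξ ω)
      have e2 := exp_mul_le_convex (s ^ 2) (ξ ω ^ 2 / s ^ 2) (sq_nonneg s) hs2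
      rw [mul_div_cancel₀ _ (by positivity)] at e2
      simp only [hW]
      linarith
    · have := Real.add_one_le_exp (s ^ 2)
      linarith
  · -- large scale: `x ≤ s²/2 + x²/(2s²)`, and `√w ≤ (1 + w)/2`
    have hs2 : 1 ≤ s ^ 2 := one_le_pow₀ h1.le
    refine key (Real.exp (s ^ 2 / 2) / 2) 0 (Real.exp (s ^ 2 / 2) / 2) (by positivity)
      (fun ω => ?_) ?_
    · have e2 := exp_mul_le_convex (1 / 2) (ξ ω ^ 2 / s ^ 2) (by norm_num) (by norm_num)
      have e3 : Real.exp (ξ ω) ≤ Real.exp (s ^ 2 / 2) * Real.exp (1 / 2 * (ξ ω ^ 2 / s ^ 2)) := by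
        rw [← Real.exp_add]
        apply Real.exp_le_exp.2
        have : s ^ 2 / 2 + 1 / 2 * (ξ ω ^ 2 / s ^ 2) - ξ ω = (s - ξ ω / s) ^ 2 / 2 := by
          field_simp; ring
        nlinarith [sq_nonneg (s - ξ ω / s)]
      have := mul_le_mul_of_nonneg_left e2 (Real.exp_pos (s ^ 2 / 2)).le
      simp only [hW]
      linarith
    · have e1 : Real.exp (s ^ 2) = Real.exp (s ^ 2 / 2) * Real.exp (s ^ 2 / 2) := by
        rw [← Real.exp_add]; ring_nf
      have e2 : 3 / 2 ≤ Real.exp (s ^ 2 / 2) := by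
        have := Real.add_one_le_exp (s ^ 2 / 2); linarith
      rw [e1]
      nlinarith [Real.exp_pos (s ^ 2 / 2)]

/-- A centered random variable with `ψ₂`-norm at most `σ` has moment generating function at most
`exp (a² σ²)`. -/
theorem lintegral_exp_mul_le {ξ : Ω → ℝ} (hm : Measurable ξ) (hi : Integrable ξ P)
    (h0 : ∫ ω, ξ ω ∂P = 0) {σ : ℝ} (hσ : 0 ≤ σ) (h : psi2Norm P ξ ≤ ENNReal.ofReal σ) (a : ℝ) :
    ∫⁻ ω, ENNReal.ofReal (Real.exp (a * ξ ω)) ∂P ≤ ENNReal.ofReal (Real.exp (a ^ 2 * σ ^ 2)) := by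
  rcases eq_or_ne a 0 with rfl | ha
  · simp
  -- the infimum defining `psi2Norm` need not be attained at `σ`: bound at every `s > σ`, then let
  -- `s` decrease to `σ`
  have step : ∀ s : ℝ, σ < s → ∫⁻ ω, ENNReal.ofReal (Real.exp (a * ξ ω)) ∂P ≤
      ENNReal.ofReal (Real.exp (a ^ 2 * s ^ 2)) := by
    intro s hs
    have hs0 : 0 < s := hσ.trans_lt hs
    have : psi2Norm P ξ < ENNReal.ofReal s :=
      h.trans_lt ((ENNReal.ofReal_lt_ofReal_iff hs0).2 hs)
    obtain ⟨_, ⟨r, ⟨hr0, hr⟩, rfl⟩, hrs⟩ := sInf_lt_iff.1 this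
    have hrs' : r < s := (ENNReal.ofReal_lt_ofReal_iff hs0).1 hrs
    have h2 := lintegral_exp_le_of_exp_sq (P := P) (ξ := fun ω => a * ξ ω) (by fun_prop)
      (hi.const_mul a) (by rw [integral_const_mul, h0, mul_zero]) (s := |a| * r) (by positivity)
      (by
        refine le_trans (le_of_eq ?_) hr
        congr 1 with ω
        congr 2
        rw [mul_pow, mul_pow, sq_abs]
        field_simp)
    refine h2.trans (ENNReal.ofReal_le_ofReal (Real.exp_le_exp.2 ?_))
    rw [mul_pow, sq_abs]
    gcongr
  have hlim : Filter.Tendsto (fun s : ℝ => ENNReal.ofReal (Real.exp (a ^ 2 * s ^ 2)))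
      (nhdsWithin σ (Set.Ioi σ)) (nhds (ENNReal.ofReal (Real.exp (a ^ 2 * σ ^ 2)))) := by
    have : Continuous fun s : ℝ => ENNReal.ofReal (Real.exp (a ^ 2 * s ^ 2)) :=
      ENNReal.continuous_ofReal.comp (by fun_prop)
    exact this.continuousAt.tendsto.mono_left nhdsWithin_le_nhds
  exact ge_of_tendsto hlim (Filter.eventually_of_mem self_mem_nhdsWithin fun s hs => step s hs)

/-- The moment generating function of `ξ` is bounded by that of a centered Gaussian vector with
covariance `2 σ² I`. -/
def HasMgfBound (P : Measure Ω) {n : ℕ} (ξ : Ω → Fin n → ℝ) (σ : ℝ) : Prop :=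
  ∀ α : Fin n → ℝ, ∫⁻ ω, ENNReal.ofReal (Real.exp (ξ ω ⬝ᵥ α)) ∂P ≤
    ENNReal.ofReal (Real.exp (σ ^ 2 * l2Sq α))

theorem l2Sq_nonneg {n : ℕ} (v : Fin n → ℝ) : 0 ≤ l2Sq v :=
  Finset.sum_nonneg fun _ _ => sq_nonneg _

theorem measurable_dotProduct_const {n : ℕ} {ξ : Ω → Fin n → ℝ} (hm : Measurable ξ)
    (α : Fin n → ℝ) : Measurable fun ω => ξ ω ⬝ᵥ α := by
  unfold dotProduct
  fun_prop

theorem IsSubGaussianVec.hasMgfBound {n : ℕ} {ξ : Ω → Fin n → ℝ} {σ : ℝ} (hσ : 0 ≤ σ)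
    (hm : Measurable ξ) (h : IsSubGaussianVec P ξ σ) : HasMgfBound P ξ σ := by
  intro α
  have := lintegral_exp_mul_le (measurable_dotProduct_const hm α) (h α).1.integrable
    (h α).1.mean_zero (mul_nonneg hσ (Real.sqrt_nonneg _)) (h α).2 1
  simpa [mul_pow, Real.sq_sqrt (l2Sq_nonneg α)] using this

theorem IsIndepSubGaussian.hasMgfBound {n : ℕ} {ξ : Ω → Fin n → ℝ} {σ : ℝ} (hσ : 0 ≤ σ)
    (hm : Measurable ξ) (h : IsIndepSubGaussian P ξ σ) : HasMgfBound P ξ σ := by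
  intro α
  have hind := h.1.comp (fun i x => ENNReal.ofReal (Real.exp (α i * x))) (fun i => by fun_prop)
  have hprod := ProbabilityTheory.lintegral_prod_eq_prod_lintegral_of_indepFun Finset.univ _ hind
    (fun i => by fun_prop)
  simp only [Function.comp_apply] at hprod
  calc ∫⁻ ω, ENNReal.ofReal (Real.exp (ξ ω ⬝ᵥ α)) ∂P
      = ∫⁻ ω, ∏ i, ENNReal.ofReal (Real.exp (α i * ξ ω i)) ∂P := by
        congr 1 with ω
        rw [← ENNReal.ofReal_prod_of_nonneg fun _ _ => (Real.exp_pos _).le, ← Real.exp_sum]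
        simp [dotProduct, mul_comm]
    _ = ∏ i, ∫⁻ ω, ENNReal.ofReal (Real.exp (α i * ξ ω i)) ∂P := hprod
    _ ≤ ∏ i, ENNReal.ofReal (Real.exp (α i ^ 2 * σ ^ 2)) :=
        Finset.prod_le_prod' fun i _ => lintegral_exp_mul_le (by fun_prop) (h.2 i).1.integrable
          (h.2 i).1.mean_zero hσ (h.2 i).2 (α i)
    _ = _ := by
        rw [← ENNReal.ofReal_prod_of_nonneg fun _ _ => (Real.exp_pos _).le, ← Real.exp_sum]
        congr 2
        rw [l2Sq, Finset.mul_sum]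
        exact Finset.sum_congr rfl fun i _ => mul_comm _ _

/-- With scale `0` the vector vanishes almost surely. -/
theorem HasMgfBound.ae_eq_zero {n : ℕ} {ξ : Ω → Fin n → ℝ} (hm : Measurable ξ)
    (h : HasMgfBound P ξ 0) : ∀ᵐ ω ∂P, ξ ω = 0 := by
  have hi : ∀ i, ∀ᵐ ω ∂P, ξ ω i = 0 := by
    intro i
    have h1 := h (Pi.single i 1)
    have h2 := h (Pi.single i (-1))
    simp only [dotProduct_single, mul_one, mul_neg, ne_eq, OfNat.ofNat_ne_zero,
      not_false_eq_true, zero_pow, zero_mul, Real.exp_zero, ENNReal.ofReal_one] at h1 h2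
    have hmi : Measurable fun ω => ξ ω i := by fun_prop
    -- `exp x + exp (-x) = 2 + (exp (x/2) - exp (-x/2))²` has mean at most `2`
    have hle : ∫⁻ ω, (2 + ENNReal.ofReal ((Real.exp (ξ ω i / 2) - Real.exp (-ξ ω i / 2)) ^ 2)) ∂P
        ≤ 2 := by
      calc _ = ∫⁻ ω, (ENNReal.ofReal (Real.exp (ξ ω i)) + ENNReal.ofReal (Real.exp (-ξ ω i))) ∂P := by
            congr 1 with ω
            rw [← ENNReal.ofReal_add (Real.exp_pos _).le (Real.exp_pos _).le,
              show (2 : ENNReal) = ENNReal.ofReal 2 by simp,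
              ← ENNReal.ofReal_add (by norm_num) (sq_nonneg _)]
            congr 1
            have e1 : Real.exp (ξ ω i) = Real.exp (ξ ω i / 2) ^ 2 := by
              rw [← Real.exp_nat_mul]; congr 1; push_cast; ring
            have e2 : Real.exp (-ξ ω i) = Real.exp (-ξ ω i / 2) ^ 2 := by
              rw [← Real.exp_nat_mul]; congr 1; push_cast; ring
            have e3 : Real.exp (ξ ω i / 2) * Real.exp (-ξ ω i / 2) = 1 := by
              rw [← Real.exp_add, ← Real.exp_zero]; congr 1; ring
            rw [e1, e2]; nlinarith
        _ ≤ 1 + 1 := by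
            rw [lintegral_add_left (by fun_prop)]
            exact add_le_add h1 h2
        _ = 2 := one_add_one_eq_two
    rw [lintegral_add_left (by fun_prop)] at hle
    simp only [lintegral_const, measure_univ, mul_one] at hle
    have hz : ∫⁻ ω, ENNReal.ofReal ((Real.exp (ξ ω i / 2) - Real.exp (-ξ ω i / 2)) ^ 2) ∂P = 0 := by
      by_contra hne
      exact absurd hle (not_le.2 (ENNReal.lt_add_right (by simp) hne))
    rw [lintegral_eq_zero_iff (by fun_prop)] at hz
    filter_upwards [hz] with ω hω
    have : (Real.exp (ξ ω i / 2) - Real.exp (-ξ ω i / 2)) ^ 2 ≤ 0 := by simpa using hω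
    have h3 : Real.exp (ξ ω i / 2) = Real.exp (-ξ ω i / 2) := by
      have := pow_eq_zero_iff (two_ne_zero) |>.1 (le_antisymm this (sq_nonneg _))
      linarith
    have := Real.exp_injective h3
    linarith
  filter_upwards [ae_all_iff.2 hi] with ω hω
  exact funext hω

end

/-! ### Gaussian decoupling -/

open ProbabilityTheory in
theorem lintegral_exp_mul_gaussianReal (s : ℝ) :
    ∫⁻ g, ENNReal.ofReal (Real.exp (s * g)) ∂(gaussianReal 0 1) =
      ENNReal.ofReal (Real.exp (s ^ 2 / 2)) := by
  have h := congrFun (mgf_fun_id_gaussianReal (μ := 0) (v := 1)) s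
  rw [← ofReal_integral_eq_lintegral_ofReal (integrable_exp_mul_gaussianReal s)
    (ae_of_all _ fun _ => (Real.exp_pos _).le)]
  rw [mgf] at h
  rw [h]
  simp

open ProbabilityTheory in
/-- Square exponential moments of a standard Gaussian: compare the densities of `N(0,1)` and
`N(0,2)`. -/
theorem lintegral_exp_sq_gaussianReal_le {θ : ℝ} (hθ : θ ≤ 1 / 4) :
    ∫⁻ g, ENNReal.ofReal (Real.exp (θ * g ^ 2)) ∂(gaussianReal 0 1) ≤ 2 := by
  rw [gaussianReal_of_var_ne_zero _ one_ne_zero,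
    lintegral_withDensity_eq_lintegral_mul _ (measurable_gaussianPDF 0 1) (by fun_prop)]
  calc _ ≤ ∫⁻ g, 2 * gaussianPDF 0 2 g := by
        apply lintegral_mono
        intro g
        simp only [Pi.mul_apply, gaussianPDF]
        rw [← ENNReal.ofReal_mul (gaussianPDFReal_nonneg _ _ _),
          show (2 : ENNReal) = ENNReal.ofReal 2 by simp, ← ENNReal.ofReal_mul (by norm_num)]
        apply ENNReal.ofReal_le_ofReal
        simp only [gaussianPDFReal, NNReal.coe_one, NNReal.coe_ofNat, sub_zero, mul_one]
        rw [mul_assoc, ← Real.exp_add, ← mul_assoc]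
        apply mul_le_mul _ (Real.exp_le_exp.2 (by nlinarith [sq_nonneg g])) (Real.exp_pos _).le
          (by positivity)
        rw [mul_comm 2 (√(2 * Real.pi * 2))⁻¹, ← div_eq_inv_mul, ← one_div,
          div_le_div_iff₀ (by positivity) (by positivity), Real.sqrt_mul (by positivity) 2]
        nlinarith [Real.sq_sqrt (show (0:ℝ) ≤ 2 by norm_num), Real.sqrt_nonneg 2,
          Real.sqrt_nonneg (2 * Real.pi), mul_nonneg (Real.sqrt_nonneg (2 * Real.pi))
          (show 0 ≤ 2 - √2 by nlinarith [Real.sq_sqrt (show (0:ℝ) ≤ 2 by norm_num), Real.sqrt_nonneg 2])]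
    _ = 2 := by
        rw [lintegral_const_mul _ (measurable_gaussianPDF 0 2),
          lintegral_gaussianPDF_eq_one 0 two_ne_zero, mul_one]

open ProbabilityTheory in
theorem lintegral_pi_gaussian_prod {k : ℕ} (f : Fin k → ℝ → ENNReal) (hf : ∀ i, Measurable (f i)) :
    ∫⁻ g, ∏ i, f i (g i) ∂(Measure.pi fun _ : Fin k => gaussianReal 0 1) =
      ∏ i, ∫⁻ x, f i x ∂(gaussianReal 0 1) := by
  have hind : iIndepFun (fun i (g : Fin k → ℝ) => f i (g i))
      (Measure.pi fun _ : Fin k => gaussianReal 0 1) :=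
    iIndepFun_pi fun i => (hf i).aemeasurable
  rw [lintegral_prod_eq_prod_lintegral_of_indepFun Finset.univ _ hind
    (fun i => (hf i).comp (measurable_pi_apply i))]
  refine Finset.prod_congr rfl fun i _ => ?_
  exact (measurePreserving_eval (fun _ : Fin k => gaussianReal 0 1) i).lintegral_comp (hf i)

/-- Gaussian decoupling: the square exponential moment of the coordinates of a vector with
sub-Gaussian moment generating function, along an orthonormal family. -/
theorem HasMgfBound.lintegral_exp_sum_sq_le {Ω : Type*} [MeasurableSpace Ω] {P : Measure Ω}
    [IsProbabilityMeasure P] {n k : ℕ} {ξ : Ω → Fin n → ℝ} {σ : ℝ} (hm : Measurable ξ)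
    (h : HasMgfBound P ξ σ) (u : Fin k → Fin n → ℝ)
    (hu : ∀ c : Fin k → ℝ, l2Sq (∑ i, c i • u i) = ∑ i, c i ^ 2) {l : ℝ} (hl0 : 0 ≤ l)
    (hl : l * σ ^ 2 ≤ 1 / 8) :
    ∫⁻ ω, ENNReal.ofReal (Real.exp (l * ∑ i, (ξ ω ⬝ᵥ u i) ^ 2)) ∂P ≤ 2 ^ k := by
  set μ := Measure.pi fun _ : Fin k => ProbabilityTheory.gaussianReal 0 1 with hμ
  set r := √(2 * l) with hr
  have hr2 : r ^ 2 = 2 * l := Real.sq_sqrt (by linarith)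
  -- `exp (a² / 2)` is the mean of `exp (a g)` for a standard Gaussian `g`
  have expand : ∀ ω, ENNReal.ofReal (Real.exp (l * ∑ i, (ξ ω ⬝ᵥ u i) ^ 2)) =
      ∫⁻ g, ENNReal.ofReal (Real.exp (ξ ω ⬝ᵥ (∑ i, (r * g i) • u i))) ∂μ := by
    intro ω
    calc _ = ∏ i, ∫⁻ x, ENNReal.ofReal (Real.exp ((r * (ξ ω ⬝ᵥ u i)) * x))
          ∂(ProbabilityTheory.gaussianReal 0 1) := by
          simp_rw [lintegral_exp_mul_gaussianReal]
          rw [← ENNReal.ofReal_prod_of_nonneg fun _ _ => (Real.exp_pos _).le, ← Real.exp_sum,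
            Finset.mul_sum]
          congr 2
          refine Finset.sum_congr rfl fun i _ => ?_
          rw [mul_pow, hr2]; ring
      _ = _ := by
          rw [← lintegral_pi_gaussian_prod _ (fun i => by fun_prop)]
          congr 1 with g
          rw [← ENNReal.ofReal_prod_of_nonneg fun _ _ => (Real.exp_pos _).le, ← Real.exp_sum,
            dotProduct_sum]
          congr 2
          refine Finset.sum_congr rfl fun i _ => ?_
          rw [dotProduct_smul, smul_eq_mul]; ring
  simp_rw [expand]
  rw [lintegral_lintegral_swap]
  · calc _ ≤ ∫⁻ g, ∏ i, ENNReal.ofReal (Real.exp ((2 * l * σ ^ 2) * g i ^ 2)) ∂μ := by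
          refine lintegral_mono fun g => (h _).trans (le_of_eq ?_)
          rw [hu, ← ENNReal.ofReal_prod_of_nonneg fun _ _ => (Real.exp_pos _).le, ← Real.exp_sum,
            Finset.mul_sum]
          congr 2
          refine Finset.sum_congr rfl fun i _ => ?_
          rw [mul_pow, hr2]; ring
      _ = ∏ i : Fin k, ∫⁻ x, ENNReal.ofReal (Real.exp ((2 * l * σ ^ 2) * x ^ 2))
            ∂(ProbabilityTheory.gaussianReal 0 1) :=
          lintegral_pi_gaussian_prod (fun _ x => ENNReal.ofReal (Real.exp ((2 * l * σ ^ 2) * x ^ 2)))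
            (fun i => by fun_prop)
      _ ≤ ∏ _i : Fin k, 2 :=
          Finset.prod_le_prod' fun i _ => lintegral_exp_sq_gaussianReal_le (by linarith)
      _ = 2 ^ k := by simp
  · have : Measurable fun z : Ω × (Fin k → ℝ) =>
        ENNReal.ofReal (Real.exp (ξ z.1 ⬝ᵥ (∑ i, (r * z.2 i) • u i))) := by
      simp only [dotProduct, Finset.sum_apply, Pi.smul_apply, smul_eq_mul]
      fun_prop
    exact this.aemeasurable

/-! ### Orthonormal coordinates -/

theorem l2Sq_eq_dotProduct {n : ℕ} (v : Fin n → ℝ) : l2Sq v = v ⬝ᵥ v := by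
  simp [l2Sq, dotProduct, sq]

/-- The range of a matrix with `d` columns is spanned by an orthonormal family of at most `d`
vectors. Orthonormality is expressed through the norm of linear combinations. -/
theorem exists_orthonormal_range {n : ℕ} {ι : Type*} [Fintype ι] (A : Matrix (Fin n) ι ℝ) :
    ∃ k ≤ Fintype.card ι, ∃ u : Fin k → Fin n → ℝ,
      (∀ c : Fin k → ℝ, l2Sq (∑ i, c i • u i) = ∑ i, c i ^ 2) ∧
      ∀ w, ∃ c : Fin k → ℝ, A *ᵥ w = ∑ i, c i • u i := by
  classical
  let f : (ι → ℝ) →ₗ[ℝ] EuclideanSpace ℝ (Fin n) :=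
    (WithLp.linearEquiv 2 ℝ (Fin n → ℝ)).symm.toLinearMap ∘ₗ A.mulVecLin
  let V := LinearMap.range f
  let b := stdOrthonormalBasis ℝ V
  have hsum : ∀ c : Fin (Module.finrank ℝ V) → ℝ,
      (∑ i, c i • (WithLp.ofLp (b i : EuclideanSpace ℝ (Fin n)))) =
        WithLp.ofLp ((∑ i, c i • b i : V) : EuclideanSpace ℝ (Fin n)) := by
    intro c
    simp [WithLp.ofLp_sum]
  refine ⟨Module.finrank ℝ V, ?_, fun i => WithLp.ofLp (b i : EuclideanSpace ℝ (Fin n)), ?_, ?_⟩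
  · simpa using LinearMap.finrank_range_le f
  · intro c
    have h1 : ‖(∑ i, c i • b i : V)‖ ^ 2 = ∑ i, c i ^ 2 := by
      rw [← real_inner_self_eq_norm_sq, b.orthonormal.inner_sum c c]
      simp [sq]
    rw [hsum, ← h1, Submodule.coe_norm, EuclideanSpace.norm_sq_eq]
    simp [l2Sq]
  · intro w
    let v : V := ⟨f w, LinearMap.mem_range_self f w⟩
    refine ⟨fun i => b.repr v i, ?_⟩
    rw [hsum, b.sum_repr v]
    simp [v, f]

/-- On the span of an orthonormal family, `2⟨e, v⟩ - ‖v‖²` is at most the squared norm of the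
projection of `e`. -/
theorem two_mul_dotProduct_le {n k : ℕ} (e : Fin n → ℝ) (u : Fin k → Fin n → ℝ)
    (hu : ∀ c : Fin k → ℝ, l2Sq (∑ i, c i • u i) = ∑ i, c i ^ 2) (c : Fin k → ℝ) :
    2 * (e ⬝ᵥ ∑ i, c i • u i) ≤ l2Sq (∑ i, c i • u i) + ∑ i, (e ⬝ᵥ u i) ^ 2 := by
  rw [hu, dotProduct_sum, Finset.mul_sum, ← Finset.sum_add_distrib]
  refine Finset.sum_le_sum fun i _ => ?_
  rw [dotProduct_smul, smul_eq_mul]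
  nlinarith [sq_nonneg (c i - e ⬝ᵥ u i)]

section
variable {Ω : Type*} [MeasurableSpace Ω] {P : Measure Ω} [IsProbabilityMeasure P]

/-! ### Tail bounds for the projected noise -/

/-- Tail bound for the noise on the range of a matrix with `d` columns: outside an event of
probability at most `2 ^ d e⁻ᵗ`, the excess `2⟨ξ, v⟩ - ‖v‖²` is at most `8 σ² t` for all `v` in the
range. -/
theorem HasMgfBound.exists_event_range {n : ℕ} {ξ : Ω → Fin n → ℝ} {σ : ℝ} (hσ : 0 ≤ σ)
    (hm : Measurable ξ) (h : HasMgfBound P ξ σ) {ι : Type*} [Fintype ι] (A : Matrix (Fin n) ι ℝ) (t : ℝ) :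
    ∃ E : Set Ω, MeasurableSet E ∧ P.real Eᶜ ≤ 2 ^ Fintype.card ι * Real.exp (-t) ∧
      ∀ ω ∈ E, ∀ w, 2 * (ξ ω ⬝ᵥ A *ᵥ w) ≤ l2Sq (A *ᵥ w) + 8 * σ ^ 2 * t := by
  -- for `σ = 0` the exponential moment has no natural scale, but the noise vanishes
  rcases hσ.eq_or_lt with rfl | hσ
  · refine ⟨{ω | ξ ω = 0}, measurableSet_eq_fun hm measurable_const, ?_, ?_⟩
    · have : P {ω | ξ ω = 0}ᶜ = 0 := h.ae_eq_zero hm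
      rw [measureReal_def, this]
      simp only [ENNReal.toReal_zero]; positivity
    · intro ω hω w
      have hω' : ξ ω = 0 := hω
      rw [hω', zero_dotProduct]
      have := l2Sq_nonneg (A *ᵥ w)
      simpa using this
  · obtain ⟨k, hk, u, hu, hA⟩ := exists_orthonormal_range A
    set Z : Ω → ℝ := fun ω => ∑ i, (ξ ω ⬝ᵥ u i) ^ 2 with hZ
    have hZm : Measurable Z := by
      have := fun i => measurable_dotProduct_const hm (u i)
      fun_prop
    set l : ℝ := 1 / (8 * σ ^ 2) with hl
    have hl0 : 0 < l := by positivity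
    have hint := h.lintegral_exp_sum_sq_le hm u hu hl0.le
      (show l * σ ^ 2 ≤ 1 / 8 by rw [hl]; field_simp; exact le_rfl)
    refine ⟨{ω | Z ω ≤ 8 * σ ^ 2 * t}, measurableSet_le hZm measurable_const, ?_, ?_⟩
    · have hmk := mul_meas_ge_le_lintegral (μ := P)
        (f := fun ω => ENNReal.ofReal (Real.exp (l * Z ω))) (by fun_prop)
        (ENNReal.ofReal (Real.exp t))
      have hsub : {ω | Z ω ≤ 8 * σ ^ 2 * t}ᶜ ⊆
          {ω | ENNReal.ofReal (Real.exp t) ≤ ENNReal.ofReal (Real.exp (l * Z ω))} := by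
        intro ω hω
        have hω' : 8 * σ ^ 2 * t < Z ω := not_le.1 hω
        refine ENNReal.ofReal_le_ofReal (Real.exp_le_exp.2 ?_)
        rw [hl, one_div, ← div_eq_inv_mul, le_div_iff₀ (by positivity)]
        linarith
      have h1 : ENNReal.ofReal (Real.exp t) * P {ω | Z ω ≤ 8 * σ ^ 2 * t}ᶜ ≤ 2 ^ k :=
        (mul_le_mul_right (measure_mono hsub) _).trans (hmk.trans hint)
      have h2 : Real.exp t * P.real {ω | Z ω ≤ 8 * σ ^ 2 * t}ᶜ ≤ 2 ^ k := by
        have := ENNReal.toReal_mono (by simp) h1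
        rw [ENNReal.toReal_mul, ENNReal.toReal_ofReal (Real.exp_pos t).le] at this
        simpa [measureReal_def] using this
      have h3 : (2 : ℝ) ^ k ≤ 2 ^ Fintype.card ι := pow_le_pow_right₀ (by norm_num) hk
      rw [Real.exp_neg, ← div_eq_mul_inv, le_div_iff₀ (Real.exp_pos t)]
      linarith
    · intro ω hω w
      obtain ⟨c, hc⟩ := hA w
      have := two_mul_dotProduct_le (ξ ω) u hu c
      have hω' : Z ω ≤ 8 * σ ^ 2 * t := hω
      rw [hc]
      simp only [hZ] at hω'
      linarith

/-- `C(n, m) ≤ (en/m)^m`. -/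
theorem choose_le_exp_mul_log {n m : ℕ} (hm : 0 < m) (hmn : m ≤ n) :
    (n.choose m : ℝ) ≤ Real.exp (m * Real.log (Real.exp 1 * n / m)) := by
  have hm' : (0 : ℝ) < m := by exact_mod_cast hm
  have hn' : (0 : ℝ) < n := by exact_mod_cast hm.trans_le hmn
  have h1 := Nat.choose_le_pow_div (α := ℝ) m n
  have h2 := Real.pow_div_factorial_le_exp (m : ℝ) hm'.le m
  have h3 : Real.exp (m * Real.log (Real.exp 1 * n / m)) = Real.exp m * n ^ m / m ^ m := by
    rw [mul_comm, Real.exp_mul, Real.exp_log (by positivity), Real.rpow_natCast, div_pow, mul_pow,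
      ← Real.exp_nat_mul, mul_one]
  rw [h3, le_div_iff₀ (by positivity)]
  have hf : (0 : ℝ) < m.factorial := by exact_mod_cast m.factorial_pos
  calc (n.choose m : ℝ) * m ^ m ≤ n ^ m / m.factorial * m ^ m := by gcongr
    _ = (m ^ m / m.factorial) * n ^ m := by ring
    _ ≤ _ := by gcongr

theorem one_le_log_exp_mul_div {n m : ℕ} (hm : 0 < m) (hmn : m ≤ n) :
    1 ≤ Real.log (Real.exp 1 * n / m) := by
  have hm' : (0 : ℝ) < m := by exact_mod_cast hm
  have hmn' : (m : ℝ) ≤ n := by exact_mod_cast hmn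
  rw [Real.le_log_iff_exp_le (by have := hm'.trans_le hmn'; positivity), le_div_iff₀ hm']
  gcongr

theorem log_le_mul_log {n m : ℕ} (hm : 0 < m) (hmn : m ≤ n) :
    Real.log n ≤ m * Real.log (Real.exp 1 * n / m) := by
  have hm' : (1 : ℝ) ≤ m := by exact_mod_cast hm
  have hmn' : (m : ℝ) ≤ n := by exact_mod_cast hmn
  have hn' : (0 : ℝ) < n := by linarith
  have e : Real.log (Real.exp 1 * n / m) = 1 + Real.log n - Real.log m := by
    rw [Real.log_div (by positivity) (by positivity), Real.log_mul (by positivity) (by positivity),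
      Real.log_exp]
  have h1 : Real.log m ≤ Real.log n := Real.log_le_log (by linarith) hmn'
  have h2 := Real.log_le_sub_one_of_pos (show (0 : ℝ) < m by linarith)
  rw [e]
  nlinarith

/-- Uniform control of the noise over the images of sparse vectors: a union bound over the
`C(n, m)` possible supports. -/
theorem HasMgfBound.exists_event_sparse {n : ℕ} (hn : 0 < n) {ξ : Ω → Fin n → ℝ} {σ : ℝ}
    (hσ : 0 ≤ σ) (hξ : Measurable ξ) (h : HasMgfBound P ξ σ) (M : Matrix (Fin n) (Fin n) ℝ)
    {m : ℕ} (hmn : m ≤ n) :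
    ∃ E : Set Ω, MeasurableSet E ∧ P.real Eᶜ ≤ (n : ℝ)⁻¹ ∧
      ∀ ω ∈ E, ∀ Δ : Fin n → ℝ, hammingNorm Δ ≤ m →
        2 * (ξ ω ⬝ᵥ M *ᵥ Δ) ≤
          l2Sq (M *ᵥ Δ) + 24 * σ ^ 2 * (m * Real.log (Real.exp 1 * n / m)) := by
  classical
  rcases Nat.eq_zero_or_pos m with rfl | hm
  · refine ⟨Set.univ, MeasurableSet.univ, by simp, fun ω _ Δ hΔ => ?_⟩
    have : Δ = 0 := hammingNorm_eq_zero.1 (Nat.le_zero.1 hΔ)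
    subst this
    simp [l2Sq]
  set Λ := Real.log (Real.exp 1 * n / m) with hΛ
  have hΛ1 : 1 ≤ Λ := one_le_log_exp_mul_div hm hmn
  have hm' : (0 : ℝ) < m := by exact_mod_cast hm
  have hn' : (0 : ℝ) < n := by exact_mod_cast hn
  have hex := fun J : Finset (Fin n) =>
    h.exists_event_range hσ hξ (M.submatrix id (Subtype.val : J → Fin n)) (3 * (m * Λ))
  choose E hE hPE hEb using hex
  set S := (Finset.univ : Finset (Fin n)).powersetCard m with hS
  refine ⟨⋂ J ∈ S, E J, Finset.measurableSet_biInter S fun J _ => hE J, ?_, ?_⟩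
  · calc P.real (⋂ J ∈ S, E J)ᶜ = P.real (⋃ J ∈ S, (E J)ᶜ) := by simp only [Set.compl_iInter]
      _ ≤ ∑ J ∈ S, P.real (E J)ᶜ := measureReal_biUnion_finset_le S _
      _ ≤ ∑ J ∈ S, 2 ^ m * Real.exp (-(3 * (m * Λ))) := by
          refine Finset.sum_le_sum fun J hJ => (hPE J).trans (le_of_eq ?_)
          rw [Fintype.card_coe, (Finset.mem_powersetCard.1 hJ).2]
      _ = n.choose m * (2 ^ m * Real.exp (-(3 * (m * Λ)))) := by
          rw [Finset.sum_const, hS, Finset.card_powersetCard, Finset.card_univ, Fintype.card_fin,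
            nsmul_eq_mul]
      _ ≤ Real.exp (m * Λ) * (Real.exp (m * Λ) * Real.exp (-(3 * (m * Λ)))) := by
          gcongr
          · exact choose_le_exp_mul_log hm hmn
          · calc (2 : ℝ) ^ m ≤ Real.exp 1 ^ m := by
                  gcongr
                  linarith [Real.add_one_le_exp 1]
              _ = Real.exp (m * 1) := (Real.exp_nat_mul 1 m).symm
              _ ≤ _ := by gcongr
      _ = Real.exp (-(m * Λ)) := by
          rw [← Real.exp_add, ← Real.exp_add]; congr 1; ring
      _ ≤ Real.exp (-Real.log n) := by
          gcongr
          exact log_le_mul_log hm hmn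
      _ = (n : ℝ)⁻¹ := by rw [Real.exp_neg, Real.exp_log hn']
  · intro ω hω Δ hΔ
    obtain ⟨J, hJs, -, hJ⟩ := Finset.exists_subsuperset_card_eq
      (Finset.subset_univ (Finset.univ.filter fun i => Δ i ≠ 0)) hΔ (by simpa using hmn)
    have hωJ : ω ∈ E J := by
      have := Set.mem_iInter₂.1 hω J
      exact this (Finset.mem_powersetCard.2 ⟨Finset.subset_univ _, hJ⟩)
    have hMΔ : M.submatrix id (Subtype.val : J → Fin n) *ᵥ (fun j => Δ j) = M *ᵥ Δ := by
      ext i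
      simp only [mulVec, dotProduct, submatrix_apply, id]
      rw [Finset.sum_coe_sort J (fun j => M i j * Δ j)]
      refine Finset.sum_subset (Finset.subset_univ _) fun j _ hj => ?_
      have : Δ j = 0 := by
        by_contra hne
        exact hj (hJs (by simpa using hne))
      rw [this, mul_zero]
    have := hEb J ω hωJ (fun j => Δ j)
    rw [hMΔ] at this
    linarith

end

/-! ### The hat matrix as an orthogonal projection -/

theorem gramPinv_transpose {n p : ℕ} (X : Matrix (Fin n) (Fin p) ℝ) :
    (gramPinv X)ᵀ = gramPinv X := by
  simp [gramPinv, Matrix.transpose_mul, Matrix.mul_assoc]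

theorem hatMatrix_transpose {n p : ℕ} (X : Matrix (Fin n) (Fin p) ℝ) :
    (hatMatrix X)ᵀ = hatMatrix X := by
  simp [hatMatrix, Matrix.transpose_mul, gramPinv_transpose, Matrix.mul_assoc]

/-- `H X = X`: the Gram matrix of the columns of `X ((XᵀX)⁺ XᵀX - 1)` vanishes by the first Penrose
equation. -/
theorem hatMatrix_mul_self_right {n p : ℕ} (X : Matrix (Fin n) (Fin p) ℝ) :
    hatMatrix X * X = X := by
  set G := gramPinv X
  have hG : Xᵀ * X * G * (Xᵀ * X) = Xᵀ * X := (gramPinv_isMoorePenroseInverse X).mul_mul_self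
  have hGt : Gᵀ = G := gramPinv_transpose X
  have e : (X * (G * (Xᵀ * X) - 1))ᵀ * (X * (G * (Xᵀ * X) - 1)) = 0 := by
    calc (X * (G * (Xᵀ * X) - 1))ᵀ * (X * (G * (Xᵀ * X) - 1))
        = (G * (Xᵀ * X) - 1)ᵀ * (Xᵀ * X * G * (Xᵀ * X) - Xᵀ * X) := by
          rw [Matrix.transpose_mul]
          simp only [Matrix.mul_sub, Matrix.mul_assoc, Matrix.mul_one]
      _ = 0 := by rw [hG, sub_self, Matrix.mul_zero]
  rw [← Matrix.conjTranspose_eq_transpose_of_trivial,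
    Matrix.conjTranspose_mul_self_eq_zero, Matrix.mul_sub, Matrix.mul_one, sub_eq_zero] at e
  rw [hatMatrix, Matrix.mul_assoc, Matrix.mul_assoc]
  exact e

theorem hatMatrix_mul_self {n p : ℕ} (X : Matrix (Fin n) (Fin p) ℝ) :
    hatMatrix X * hatMatrix X = hatMatrix X := by
  conv_lhs => rw [hatMatrix, ← Matrix.mul_assoc, ← Matrix.mul_assoc, ← hatMatrix,
    hatMatrix_mul_self_right, ← hatMatrix]

theorem mulVec_lsStep {n p : ℕ} (X : Matrix (Fin n) (Fin p) ℝ) (y γ : Fin n → ℝ) :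
    X *ᵥ lsStep X y γ = hatMatrix X *ᵥ (y - γ) := by
  simp [lsStep, hatMatrix, Matrix.mulVec_mulVec, Matrix.mul_assoc]

theorem IsBCDRun.isOneLineRun {n p q : ℕ} {X : Matrix (Fin n) (Fin p) ℝ} {y : Fin n → ℝ} {ν : ℝ}
    {β : ℕ → Fin p → ℝ} {γ : ℕ → Fin n → ℝ} (h : IsBCDRun X y q ν β γ) :
    IsOneLineRun X y q ν β γ := by
  intro t ht
  obtain ⟨t, rfl⟩ := Nat.exists_eq_add_of_le' ht
  refine ⟨?_, (h t).2⟩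
  have h1 := (h (t + 1)).1
  rw [(h t).2, mulVec_lsStep] at h1
  convert h1 using 1
  rw [Matrix.sub_mulVec, Matrix.one_mulVec, Matrix.mulVec_sub]
  abel

theorem l2Sq_add {n : ℕ} (v w : Fin n → ℝ) : l2Sq (v + w) = l2Sq v + 2 * (v ⬝ᵥ w) + l2Sq w := by
  simp only [l2Sq_eq_dotProduct, add_dotProduct, dotProduct_add, dotProduct_comm w v]
  ring

theorem l2Sq_sub {n : ℕ} (v w : Fin n → ℝ) : l2Sq (v - w) = l2Sq v - 2 * (v ⬝ᵥ w) + l2Sq w := by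
  simp only [l2Sq_eq_dotProduct, sub_dotProduct, dotProduct_sub, dotProduct_comm w v]
  ring

theorem l2Sq_neg {n : ℕ} (v : Fin n → ℝ) : l2Sq (-v) = l2Sq v := by
  simp [l2Sq]

theorem l2Sq_add_le {n : ℕ} (v w : Fin n → ℝ) : l2Sq (v + w) ≤ 2 * l2Sq v + 2 * l2Sq w := by
  have := l2Sq_nonneg (v - w)
  rw [l2Sq_sub] at this
  rw [l2Sq_add]
  linarith

theorem dotProduct_hatMatrix {n p : ℕ} (X : Matrix (Fin n) (Fin p) ℝ) (v w : Fin n → ℝ) :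
    v ⬝ᵥ hatMatrix X *ᵥ w = (hatMatrix X *ᵥ v) ⬝ᵥ w := by
  rw [Matrix.dotProduct_mulVec, ← Matrix.mulVec_transpose, hatMatrix_transpose]

theorem dotProduct_one_sub_hatMatrix {n p : ℕ} (X : Matrix (Fin n) (Fin p) ℝ) (v w : Fin n → ℝ) :
    v ⬝ᵥ (1 - hatMatrix X) *ᵥ w = ((1 - hatMatrix X) *ᵥ v) ⬝ᵥ w := by
  simp only [Matrix.sub_mulVec, Matrix.one_mulVec, dotProduct_sub, sub_dotProduct,
    dotProduct_hatMatrix]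

theorem hatMatrix_dotProduct_hatMatrix {n p : ℕ} (X : Matrix (Fin n) (Fin p) ℝ)
    (v w : Fin n → ℝ) :
    (hatMatrix X *ᵥ v) ⬝ᵥ (hatMatrix X *ᵥ w) = (hatMatrix X *ᵥ v) ⬝ᵥ w := by
  rw [dotProduct_hatMatrix, Matrix.mulVec_mulVec, hatMatrix_mul_self]

theorem l2Sq_hatMatrix_add {n p : ℕ} (X : Matrix (Fin n) (Fin p) ℝ) (v w : Fin n → ℝ) :
    l2Sq (hatMatrix X *ᵥ v + (1 - hatMatrix X) *ᵥ w) =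
      l2Sq (hatMatrix X *ᵥ v) + l2Sq ((1 - hatMatrix X) *ᵥ w) := by
  rw [l2Sq_add, Matrix.sub_mulVec, Matrix.one_mulVec, dotProduct_sub,
    hatMatrix_dotProduct_hatMatrix]
  ring

theorem l2Sq_eq_hatMatrix_add {n p : ℕ} (X : Matrix (Fin n) (Fin p) ℝ) (v : Fin n → ℝ) :
    l2Sq v = l2Sq (hatMatrix X *ᵥ v) + l2Sq ((1 - hatMatrix X) *ᵥ v) := by
  rw [← l2Sq_hatMatrix_add, Matrix.sub_mulVec, Matrix.one_mulVec, add_sub_cancel]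

/-! ### Quantile thresholding -/

/-- The set of retained coordinates of a quantile thresholding. -/
theorem IsQuantileThreshold.exists_finset {n q : ℕ} {s t : Fin n → ℝ} {ν : ℝ}
    (h : IsQuantileThreshold s q ν t) :
    ∃ J : Finset (Fin n), (∀ i ∈ J, t i = s i / (1 + ν)) ∧ (∀ i ∉ J, t i = 0) ∧
      (∀ i ∈ J, ∀ j ∉ J, |s j| ≤ |s i|) ∧ J.card ≤ q ∧ (q ≤ J.card ∨ J = Finset.univ) := by
  obtain ⟨π, hπ, ht⟩ := h
  have hcard : (Finset.univ.filter fun i : Fin n => ((π.symm i : Fin n) : ℕ) < q).card =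
      min n q := by
    rw [← Fin.card_filter_val_lt]
    exact Finset.card_bij (fun i _ => π.symm i) (by simp) (by simp)
      fun b hb => ⟨π b, by simpa using hb, by simp⟩
  refine ⟨Finset.univ.filter fun i => ((π.symm i : Fin n) : ℕ) < q, ?_, ?_, ?_, ?_, ?_⟩
  · intro i hi
    have := ht (π.symm i)
    simp only [Finset.mem_filter, Finset.mem_univ, true_and] at hi
    simpa [hi] using this
  · intro i hi
    have := ht (π.symm i)
    simp only [Finset.mem_filter, Finset.mem_univ, true_and] at hi
    simpa [hi] using this
  · intro i hi j hj
    simp only [Finset.mem_filter, Finset.mem_univ, true_and] at hi hj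
    have := hπ (show π.symm i ≤ π.symm j from Fin.le_def.2 (by omega))
    simpa using this
  · rw [hcard]; exact min_le_right _ _
  · rcases le_total q n with hqn | hqn
    · left; rw [hcard]; exact le_min hqn le_rfl
    · right
      rw [Finset.filter_eq_self]
      intro i _
      have := (π.symm i).2
      omega

theorem IsQuantileThreshold.hammingNorm_le {n q : ℕ} {s t : Fin n → ℝ} {ν : ℝ}
    (h : IsQuantileThreshold s q ν t) : hammingNorm t ≤ q := by
  obtain ⟨J, -, h0, -, hJ, -⟩ := h.exists_finset
  refine (Finset.card_le_card fun i hi => ?_).trans hJ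
  by_contra hne
  exact (Finset.mem_filter.1 hi).2 (h0 i hne)

/-- Restricted strong convexity gained by keeping the `q` largest entries of `z`, against a
competitor `θ` with at most `L² q` nonzero entries: the entries of `z` kept outside the support of
`θ` dominate those of the support that are dropped, in the proportion `L² : 1`. -/
theorem l2Sq_topEntries_le {n q : ℕ} {z t θ : Fin n → ℝ} {J : Finset (Fin n)}
    (hJ : ∀ i ∈ J, t i = z i) (hJc : ∀ i ∉ J, t i = 0)
    (hz : ∀ i ∈ J, ∀ j ∉ J, |z j| ≤ |z i|) (hq : q ≤ J.card ∨ J = Finset.univ)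
    (hθq : hammingNorm θ ≤ q) {L : ℝ} (hL : 0 ≤ L) (hθ : (hammingNorm θ : ℝ) ≤ L ^ 2 * q) :
    l2Sq (z - t) + (1 - L) * l2Sq (t - θ) ≤ l2Sq (z - θ) := by
  classical
  set I := Finset.univ.filter fun i => θ i ≠ 0 with hI
  have hIθ : ∀ i ∉ I, θ i = 0 := fun i hi => by simpa [hI] using hi
  have hIc : I.card = hammingNorm θ := rfl
  set D : Fin n → ℝ := fun i => (z i - θ i) ^ 2 - (z i - t i) ^ 2 - (1 - L) * (t i - θ i) ^ 2
    with hD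
  set A := ∑ i ∈ I \ J, z i ^ 2 with hA
  set B := ∑ i ∈ J \ I, z i ^ 2 with hB
  have hA0 : 0 ≤ A := Finset.sum_nonneg fun _ _ => sq_nonneg _
  have hB0 : 0 ≤ B := Finset.sum_nonneg fun _ _ => sq_nonneg _
  have hAB : A ≤ L ^ 2 * B := by
    rcases Nat.eq_zero_or_pos (I \ J).card with h0 | h0
    · rw [hA, Finset.card_eq_zero.1 h0, Finset.sum_empty]; positivity
    · have hqJ : q ≤ J.card := by
        rcases hq with hq | rfl
        · exact hq
        · simp [Finset.sdiff_eq_empty_iff_subset.2 (Finset.subset_univ I)] at h0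
      have h1 : ((J \ I).card : ℝ) * A ≤ ((I \ J).card : ℝ) * B := by
        have : ∑ j ∈ J \ I, ∑ i ∈ I \ J, z i ^ 2 ≤ ∑ j ∈ J \ I, ∑ _i ∈ I \ J, z j ^ 2 := by
          refine Finset.sum_le_sum fun j hj => Finset.sum_le_sum fun i hi => ?_
          exact sq_le_sq.2 (hz j (Finset.mem_sdiff.1 hj).1 i (Finset.mem_sdiff.1 hi).2)
        simpa [Finset.sum_const, nsmul_eq_mul, ← Finset.mul_sum] using this
      have c1 := Finset.card_sdiff_add_card_inter I J
      have c2 := Finset.card_sdiff_add_card_inter J I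
      rw [Finset.inter_comm J I] at c2
      have c3 : q + (I \ J).card ≤ (J \ I).card + I.card := by omega
      have c4 : (I \ J).card ≤ I.card := Finset.card_le_card Finset.sdiff_subset
      rw [← hIc] at hθ hθq
      have c3' : (q : ℝ) + (I \ J).card ≤ (J \ I).card + I.card := by exact_mod_cast c3
      have c4' : ((I \ J).card : ℝ) ≤ I.card := by exact_mod_cast c4
      have ha : (0 : ℝ) < (I \ J).card := by exact_mod_cast h0
      have hkq : (I.card : ℝ) ≤ q := by exact_mod_cast hθq
      set a : ℝ := ((I \ J).card : ℝ)
      set b : ℝ := ((J \ I).card : ℝ)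
      set k : ℝ := (I.card : ℝ)
      -- `a q ≤ k (q - k + a) ≤ k b`
      have h2 : a * q ≤ k * b := by nlinarith
      have h3 : a * (q * A) ≤ a * (k * B) := by nlinarith
      have h4 : q * A ≤ k * B := le_of_mul_le_mul_left h3 ha
      have hq0 : (0 : ℝ) < q := by linarith
      have h5 : q * A ≤ q * (L ^ 2 * B) := by nlinarith
      exact le_of_mul_le_mul_left h5 hq0
  have hsplit : ∑ i, D i = ∑ i ∈ J, D i + ∑ i ∈ Jᶜ, D i := (Finset.sum_add_sum_compl J D).symm
  have hJsum : L * B ≤ ∑ i ∈ J, D i := by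
    rw [hB, Finset.mul_sum]
    have hDJ : ∀ i ∈ J, D i = L * (z i - θ i) ^ 2 := fun i hi => by
      simp only [hD, hJ i hi]; ring
    calc _ = ∑ i ∈ J \ I, D i := Finset.sum_congr rfl fun i hi => by
          rw [hDJ i (Finset.mem_sdiff.1 hi).1, hIθ i (Finset.mem_sdiff.1 hi).2, sub_zero]
      _ ≤ _ := Finset.sum_le_sum_of_subset_of_nonneg Finset.sdiff_subset fun i hi _ => by
          rw [hDJ i hi]; positivity
  have hJcsum : ∑ i ∈ Jᶜ, D i = ∑ i ∈ I \ J, (L * θ i ^ 2 - 2 * (z i * θ i)) := by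
    symm
    calc _ = ∑ i ∈ I \ J, D i := Finset.sum_congr rfl fun i hi => by
          simp only [hD, hJc i (Finset.mem_sdiff.1 hi).2]; ring
      _ = _ := by
          refine Finset.sum_subset (fun i hi => ?_) fun i hi hi' => ?_
          · exact Finset.mem_compl.2 (Finset.mem_sdiff.1 hi).2
          · have hiJ := Finset.mem_compl.1 hi
            have hiI : i ∉ I := fun h => hi' (Finset.mem_sdiff.2 ⟨h, hiJ⟩)
            simp [hD, hJc i hiJ, hIθ i hiI]
  have hpos : 0 ≤ ∑ i, D i := by
    rw [hsplit, hJcsum]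
    -- for `L = 0` the competitor vanishes, and no division by `L` is needed
    rcases hL.eq_or_lt with hL0 | hL0
    · have hIe : I = ∅ := by
        rw [← Finset.card_eq_zero, hIc]
        rw [← hL0] at hθ
        have : (hammingNorm θ : ℝ) ≤ 0 := by simpa using hθ
        exact_mod_cast le_antisymm this (Nat.cast_nonneg _)
      rw [← hL0, zero_mul] at hJsum
      simpa [hIe] using hJsum
    · have h1 : ∑ i ∈ I \ J, (-(z i ^ 2 / L)) ≤ ∑ i ∈ I \ J, (L * θ i ^ 2 - 2 * (z i * θ i)) := by
        refine Finset.sum_le_sum fun i _ => ?_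
        have : L * θ i ^ 2 - 2 * (z i * θ i) + z i ^ 2 / L = (L * θ i - z i) ^ 2 / L := by
          field_simp; ring
        have : 0 ≤ (L * θ i - z i) ^ 2 / L := by positivity
        linarith
      rw [Finset.sum_neg_distrib, ← Finset.sum_div, ← hA] at h1
      have h2 : A / L ≤ L * B := by
        rw [div_le_iff₀ hL0]; linarith
      linarith
  have e : ∑ i, D i = l2Sq (z - θ) - l2Sq (z - t) - (1 - L) * l2Sq (t - θ) := by
    simp only [hD, l2Sq, Finset.sum_sub_distrib, Finset.mul_sum, Pi.sub_apply]
  linarith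

/-- Quantile thresholding minimizes `‖s - ·‖² + ν ‖·‖²` over sparse vectors, with a quadratic gain
when the competitor is sparser than the threshold allows. -/
theorem IsQuantileThreshold.l2Sq_le {n q : ℕ} {s t θ : Fin n → ℝ} {ν : ℝ} (hν : 0 ≤ ν)
    (h : IsQuantileThreshold s q ν t) (hθq : hammingNorm θ ≤ q) {L : ℝ} (hL : 0 ≤ L)
    (hθ : (hammingNorm θ : ℝ) ≤ L ^ 2 * q) :
    l2Sq (s - t) + ν * l2Sq t + (1 + ν) * (1 - L) * l2Sq (t - θ) ≤
      l2Sq (s - θ) + ν * l2Sq θ := by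
  obtain ⟨J, hJ, hJc, hz, -, hq⟩ := h.exists_finset
  have hν1 : 0 < 1 + ν := by linarith
  have h1 := l2Sq_topEntries_le (z := fun i => s i / (1 + ν)) (θ := θ) hJ hJc
    (fun i hi j hj => by
      rw [abs_div, abs_div]
      exact div_le_div_of_nonneg_right (hz i hi j hj) (abs_nonneg _)) hq hθq hL hθ
  have square : ∀ w : Fin n → ℝ, l2Sq (s - w) + ν * l2Sq w =
      (1 + ν) * l2Sq ((fun i => s i / (1 + ν)) - w) + ∑ i, (s i ^ 2 - s i ^ 2 / (1 + ν)) := by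
    intro w
    simp only [l2Sq, Finset.mul_sum, ← Finset.sum_add_distrib, Pi.sub_apply]
    refine Finset.sum_congr rfl fun i _ => ?_
    field_simp
    ring
  rw [square t, square θ]
  nlinarith [mul_le_mul_of_nonneg_left h1 hν1.le]

/-! ### Descent and contraction along the iterates -/

section deterministic
variable {n p q : ℕ} {X : Matrix (Fin n) (Fin p) ℝ} {ν : ℝ} {β : ℕ → Fin p → ℝ}
  {γ : ℕ → Fin n → ℝ}

/-- Sufficient decrease of `‖(I - H)(y - γ)‖² + ν ‖γ‖²` along the iterates. -/
theorem IsOneLineRun.descent {y : Fin n → ℝ} (hν : 0 ≤ ν) (h : IsOneLineRun X y q ν β γ) {t : ℕ}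
    (ht : 1 ≤ t) (hγ : hammingNorm (γ t) ≤ q) :
    l2Sq ((1 - hatMatrix X) *ᵥ (γ (t + 1) - y)) + ν * l2Sq (γ (t + 1)) +
      l2Sq (hatMatrix X *ᵥ (γ t - γ (t + 1))) ≤
      l2Sq ((1 - hatMatrix X) *ᵥ (γ t - y)) + ν * l2Sq (γ t) := by
  have h1 := (h t ht).1.l2Sq_le hν hγ zero_le_one (by simpa using hγ)
  have e1 : hatMatrix X *ᵥ γ t + (1 - hatMatrix X) *ᵥ y - γ t =
      -((1 - hatMatrix X) *ᵥ (γ t - y)) := by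
    simp only [Matrix.sub_mulVec, Matrix.one_mulVec, Matrix.mulVec_sub]; abel
  have e2 : hatMatrix X *ᵥ γ t + (1 - hatMatrix X) *ᵥ y - γ (t + 1) =
      hatMatrix X *ᵥ (γ t - γ (t + 1)) + (1 - hatMatrix X) *ᵥ (-(γ (t + 1) - y)) := by
    simp only [Matrix.sub_mulVec, Matrix.one_mulVec, Matrix.mulVec_sub, Matrix.mulVec_neg]; abel
  rw [e1, e2, l2Sq_hatMatrix_add, l2Sq_neg, Matrix.mulVec_neg, l2Sq_neg] at h1
  linarith

theorem IsOneLineRun.mulVec_sub {y : Fin n → ℝ} (h : IsOneLineRun X y q ν β γ) {t : ℕ}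
    (ht : 1 ≤ t) :
    l2Sq (X *ᵥ (β t - β (t + 1))) = l2Sq (hatMatrix X *ᵥ (γ t - γ (t + 1))) := by
  rw [Matrix.mulVec_sub, (h t ht).2, (h (t + 1) (by omega)).2, mulVec_lsStep, mulVec_lsStep,
    ← l2Sq_neg, ← Matrix.mulVec_sub, ← Matrix.mulVec_neg]
  congr 2
  abel

theorem IsOneLineRun.inf_le {y : Fin n → ℝ} (hν : 0 ≤ ν) (h : IsOneLineRun X y q ν β γ)
    (hγ : hammingNorm (γ 1) ≤ q) (T : ℕ) (hT : 1 ≤ T) :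
    (Finset.Icc 1 T).inf' (Finset.nonempty_Icc.mpr hT)
        (fun t => l2Sq (hatMatrix X *ᵥ (γ t - γ (t + 1)))) ≤
      1 / (T : ℝ) * (l2Sq ((1 - hatMatrix X) *ᵥ (γ 1 - y)) + ν * l2Sq (γ 1)) := by
  set m := (Finset.Icc 1 T).inf' (Finset.nonempty_Icc.mpr hT)
        (fun t => l2Sq (hatMatrix X *ᵥ (γ t - γ (t + 1)))) with hm
  have hle : ∀ t, 1 ≤ t → t ≤ T → m ≤ l2Sq (hatMatrix X *ᵥ (γ t - γ (t + 1))) :=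
    fun t h1 h2 => Finset.inf'_le _ (Finset.mem_Icc.2 ⟨h1, h2⟩)
  have hsp : ∀ t, 1 ≤ t → hammingNorm (γ t) ≤ q := by
    intro t ht
    induction t, ht using Nat.le_induction with
    | base => exact hγ
    | succ t ht _ => exact (h t ht).1.hammingNorm_le
  have hsum : ∀ t : ℕ, t ≤ T →
      t * m + (l2Sq ((1 - hatMatrix X) *ᵥ (γ (t + 1) - y)) + ν * l2Sq (γ (t + 1))) ≤
      l2Sq ((1 - hatMatrix X) *ᵥ (γ 1 - y)) + ν * l2Sq (γ 1) := by
    intro t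
    induction t with
    | zero => intro _; simp
    | succ t ih =>
      intro ht
      have h1 := ih (by omega)
      have h2 := h.descent hν (t := t + 1) (by omega) (hsp _ (by omega))
      have h3 := hle (t + 1) (by omega) ht
      push_cast
      linarith
  have h1 := hsum T le_rfl
  have h2 := l2Sq_nonneg ((1 - hatMatrix X) *ᵥ (γ (T + 1) - y))
  have h3 := mul_nonneg hν (l2Sq_nonneg (γ (T + 1)))
  have hT' : (0 : ℝ) < T := by exact_mod_cast hT
  rw [one_div, ← div_eq_inv_mul, le_div_iff₀ hT']
  linarith

variable {βs : Fin p → ℝ} {γs e : Fin n → ℝ} {ϑ ε : ℝ}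

/-- One step contracts the error `‖H (γ - γ*)‖²` by the factor `1 / (1 + κ)`, up to the bias
`ν ‖γ*‖²` and the noise level `R`. -/
theorem IsOneLineRun.contraction (hν : 0 ≤ ν)
    (h : IsOneLineRun X (X *ᵥ βs + γs + e) q ν β γ) (hϑ : 1 < ϑ)
    (hq : (q : ℝ) = ϑ * (hammingNorm γs : ℝ)) (hε : ε < 1)
    (hH : HatRIP X ε ((1 + ϑ) * (hammingNorm γs : ℝ))) (hκ : 0 < rateKappa ε ϑ ν) {R : ℝ}
    (hR : ∀ Δ : Fin n → ℝ, hammingNorm Δ ≤ hammingNorm γs + q →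
      2 * (e ⬝ᵥ (1 - hatMatrix X) *ᵥ Δ) ≤ l2Sq ((1 - hatMatrix X) *ᵥ Δ) + R) {t : ℕ}
    (ht : 1 ≤ t) :
    (1 + rateKappa ε ϑ ν) * l2Sq (hatMatrix X *ᵥ (γ (t + 1) - γs)) ≤
      l2Sq (hatMatrix X *ᵥ (γ t - γs)) + (ν * l2Sq γs + R) := by
  set H := hatMatrix X with hHdef
  set Δ := γ t - γs with hΔ
  set Δ' := γ (t + 1) - γs with hΔ'
  have hϑ0 : 0 < ϑ := by linarith
  have ho : hammingNorm γs ≤ q := by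
    have : (hammingNorm γs : ℝ) ≤ q := by
      rw [hq]; nlinarith [Nat.cast_nonneg (α := ℝ) (hammingNorm γs)]
    exact_mod_cast this
  have hL : (1 / √ϑ) ^ 2 = 1 / ϑ := by rw [div_pow, one_pow, Real.sq_sqrt hϑ0.le]
  have h1 := (h t ht).1.l2Sq_le hν ho (L := 1 / √ϑ) (by positivity)
    (by rw [hL, hq]; field_simp; exact le_rfl)
  have hsparse : hammingNorm Δ' ≤ hammingNorm γs + q := by
    have h2 := (h t ht).1.hammingNorm_le
    have h3 : hammingNorm Δ' ≤ hammingNorm (γ (t + 1)) + hammingNorm γs := by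
      have h4 := hammingDist_triangle (γ (t + 1)) 0 γs
      rwa [hammingDist_zero_right, hammingDist_zero_left, hammingDist_comm,
        hammingDist_eq_hammingNorm, neg_add_eq_sub] at h4
    omega
  have hnoise := hR Δ' hsparse
  have hrip := hH Δ' (by
    have : (hammingNorm Δ' : ℝ) ≤ hammingNorm γs + q := by exact_mod_cast hsparse
    rw [hq] at this; linarith)
  have hHX : (1 - H) *ᵥ (X *ᵥ βs) = 0 := by
    rw [Matrix.mulVec_mulVec, Matrix.sub_mul, Matrix.one_mul, hHdef, hatMatrix_mul_self_right,
      sub_self, Matrix.zero_mulVec]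
  have e1 : H *ᵥ γ t + (1 - H) *ᵥ (X *ᵥ βs + γs + e) - γs = H *ᵥ Δ + (1 - H) *ᵥ e := by
    rw [Matrix.mulVec_add, Matrix.mulVec_add, hHX, hΔ, Matrix.mulVec_sub, Matrix.sub_mulVec 1 H γs,
      Matrix.one_mulVec]
    abel
  have e2 : H *ᵥ γ t + (1 - H) *ᵥ (X *ᵥ βs + γs + e) - γ (t + 1) =
      (H *ᵥ Δ + (1 - H) *ᵥ e) - Δ' := by
    rw [← e1, hΔ']; abel
  have e3 : (H *ᵥ Δ + (1 - H) *ᵥ e) ⬝ᵥ Δ' = (H *ᵥ Δ) ⬝ᵥ (H *ᵥ Δ') + e ⬝ᵥ (1 - H) *ᵥ Δ' := by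
    rw [add_dotProduct, hHdef, hatMatrix_dotProduct_hatMatrix, dotProduct_one_sub_hatMatrix]
  rw [e1, e2, l2Sq_sub, e3, ← hΔ'] at h1
  have hpyth := l2Sq_eq_hatMatrix_add X Δ'
  rw [← hHdef] at hpyth
  have hcs := l2Sq_nonneg (H *ᵥ Δ - H *ᵥ Δ')
  rw [l2Sq_sub] at hcs
  have hγ0 := mul_nonneg hν (l2Sq_nonneg (γ (t + 1)))
  have hmain : (1 + ν) * (1 - 1 / √ϑ) * l2Sq Δ' ≤ l2Sq (H *ᵥ Δ) + (ν * l2Sq γs + R) := by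
    linarith
  have hκe : (1 + rateKappa ε ϑ ν) * (1 - ε) = (1 + ν) * (1 - 1 / √ϑ) := by
    have : 1 - ε ≠ 0 := by linarith
    rw [rateKappa, add_mul, div_mul_cancel₀ _ this]; ring
  calc _ ≤ (1 + rateKappa ε ϑ ν) * ((1 - ε) * l2Sq Δ') := by gcongr
    _ = (1 + ν) * (1 - 1 / √ϑ) * l2Sq Δ' := by rw [← mul_assoc, hκe]
    _ ≤ _ := hmain

theorem geometric_recursion {a : ℕ → ℝ} {κ B : ℝ} (hκ : 0 < κ)
    (h : ∀ t, 1 ≤ t → (1 + κ) * a (t + 1) ≤ a t + B) (hB : 0 ≤ B) (t : ℕ) (ht : 1 ≤ t) :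
    a t ≤ (1 / (1 + κ)) ^ (t - 1) * a 1 + B / κ := by
  induction t, ht using Nat.le_induction with
  | base =>
    have : 0 ≤ B / κ := by positivity
    simpa using this
  | succ t ht ih =>
    have h1 := h t ht
    have h2 : a (t + 1) ≤ 1 / (1 + κ) * (a t + B) := by
      rw [one_div, ← div_eq_inv_mul, le_div_iff₀ (by positivity)]; linarith
    have h3 : (1 / (1 + κ)) ^ (t + 1 - 1) = 1 / (1 + κ) * (1 / (1 + κ)) ^ (t - 1) := by
      rw [← pow_succ']; congr 1; omega
    calc a (t + 1) ≤ 1 / (1 + κ) * ((1 / (1 + κ)) ^ (t - 1) * a 1 + B / κ + B) :=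
          h2.trans (by gcongr)
      _ = _ := by
          rw [h3]; field_simp; ring

/-- The prediction error and the outlier error differ by the projected noise `H e`. -/
theorem IsOneLineRun.mulVec_sub_eq (h : IsOneLineRun X (X *ᵥ βs + γs + e) q ν β γ) {t : ℕ}
    (ht : 1 ≤ t) :
    X *ᵥ (β t - βs) = -(hatMatrix X *ᵥ (γ t - γs)) + hatMatrix X *ᵥ e := by
  have hHX : hatMatrix X *ᵥ (X *ᵥ βs) = X *ᵥ βs := by
    rw [Matrix.mulVec_mulVec, hatMatrix_mul_self_right]
  rw [Matrix.mulVec_sub, (h t ht).2, mulVec_lsStep]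
  simp only [Matrix.mulVec_sub, Matrix.mulVec_add, hHX]
  abel

end deterministic

/-! ### Error bounds on the noise event -/

/-- At `v = H e` the excess `2⟨e, v⟩ - ‖v‖²` equals `‖H e‖²`. -/
theorem hatMatrix_projection_noise_le {n p : ℕ} (X : Matrix (Fin n) (Fin p) ℝ) (e : Fin n → ℝ)
    {R : ℝ} (h : ∀ w, 2 * (e ⬝ᵥ X *ᵥ w) ≤ l2Sq (X *ᵥ w) + R) : l2Sq (hatMatrix X *ᵥ e) ≤ R := by
  have h1 := h (lsStep X e 0)
  rw [mulVec_lsStep, sub_zero] at h1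
  have h2 : l2Sq (hatMatrix X *ᵥ e) = e ⬝ᵥ hatMatrix X *ᵥ e := by
    rw [l2Sq_eq_dotProduct, hatMatrix_dotProduct_hatMatrix, dotProduct_comm]
  linarith

/-- The complexity of the sparsity level `m = min (o + q) n` is at most twice the target
`ϑ o log (en/o)`: capping at `n` keeps `log (en/m)` at most `log (en/o)`. -/
theorem mul_log_sparsity_le {n o q : ℕ} {ϑ : ℝ} (hϑ : 1 < ϑ) (hq : (q : ℝ) = ϑ * o) (ho : o ≤ n) :
    ((min (o + q) n : ℕ) : ℝ) * Real.log (Real.exp 1 * n / (min (o + q) n : ℕ)) ≤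
      2 * (ϑ * o * Real.log (Real.exp 1 * n / o)) := by
  rcases Nat.eq_zero_or_pos o with rfl | ho0
  · have hq0 : q = 0 := by simpa using hq
    simp [hq0]
  set m := min (o + q) n with hm
  have hom : o ≤ m := le_min (by omega) ho
  have hmn : m ≤ n := min_le_right _ _
  have hm0 : 0 < m := by omega
  have hl := one_le_log_exp_mul_div hm0 hmn
  have ho' : (0 : ℝ) < o := by exact_mod_cast ho0
  have hom' : (o : ℝ) ≤ m := by exact_mod_cast hom
  have hm' : (0 : ℝ) < m := by linarith
  have hn' : (0 : ℝ) < n := by exact_mod_cast hm0.trans_le hmn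
  have hlog : Real.log (Real.exp 1 * n / m) ≤ Real.log (Real.exp 1 * n / o) := by
    gcongr
  have hmq : (m : ℝ) ≤ 2 * (ϑ * o) := by
    have : (m : ℝ) ≤ o + q := by exact_mod_cast min_le_left (o + q) n
    rw [hq] at this
    nlinarith
  calc _ ≤ (2 * (ϑ * o)) * Real.log (Real.exp 1 * n / o) := by gcongr
    _ = _ := by ring

section
variable {n p q : ℕ} {X : Matrix (Fin n) (Fin p) ℝ} {βs : Fin p → ℝ} {γs e : Fin n → ℝ}
  {β : ℕ → Fin p → ℝ} {γ : ℕ → Fin n → ℝ} {ϑ ε ν σ : ℝ}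

/-- Error bound for the outlier iterates on the event that controls the noise over sparse
vectors. -/
theorem IsOneLineRun.outlier_error_le (hν : 0 ≤ ν)
    (h : IsOneLineRun X (X *ᵥ βs + γs + e) q ν β γ) (hϑ : 1 < ϑ)
    (hq : (q : ℝ) = ϑ * (hammingNorm γs : ℝ)) (hε : ε < 1)
    (hH : HatRIP X ε ((1 + ϑ) * (hammingNorm γs : ℝ))) (hκ : 0 < rateKappa ε ϑ ν)
    (hE : ∀ Δ : Fin n → ℝ, hammingNorm Δ ≤ min (hammingNorm γs + q) n →
      2 * (e ⬝ᵥ (1 - hatMatrix X) *ᵥ Δ) ≤ l2Sq ((1 - hatMatrix X) *ᵥ Δ) +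
        24 * σ ^ 2 * ((min (hammingNorm γs + q) n : ℕ) *
          Real.log (Real.exp 1 * n / (min (hammingNorm γs + q) n : ℕ))))
    {t : ℕ} (ht : 1 ≤ t) :
    l2Sq (hatMatrix X *ᵥ (γ t - γs)) ≤
      (1 / (1 + rateKappa ε ϑ ν)) ^ (t - 1) * l2Sq (hatMatrix X *ᵥ (γ 1 - γs))
        + ν / rateKappa ε ϑ ν * l2Sq γs
        + 48 * (σ ^ 2 / rateKappa ε ϑ ν * ϑ * (hammingNorm γs : ℝ) *
            Real.log (Real.exp 1 * (n : ℝ) / (hammingNorm γs : ℝ))) := by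
  set κ := rateKappa ε ϑ ν
  have hcard : ∀ Δ : Fin n → ℝ, hammingNorm Δ ≤ n := fun Δ => by
    simpa using hammingNorm_le_card_fintype (x := Δ)
  have hlog := mul_log_sparsity_le hϑ hq (hcard γs)
  set N := ((min (hammingNorm γs + q) n : ℕ) : ℝ) *
    Real.log (Real.exp 1 * n / (min (hammingNorm γs + q) n : ℕ)) with hN
  set N' := ϑ * (hammingNorm γs : ℝ) * Real.log (Real.exp 1 * n / hammingNorm γs) with hN'
  have hN0 : 0 ≤ N := by
    rcases Nat.eq_zero_or_pos (min (hammingNorm γs + q) n) with h0 | h0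
    · simp [hN, h0]
    · exact mul_nonneg (Nat.cast_nonneg _)
        (zero_le_one.trans (one_le_log_exp_mul_div h0 (min_le_right _ _)))
  have hgeo := geometric_recursion (a := fun t => l2Sq (hatMatrix X *ᵥ (γ t - γs))) hκ
    (fun t ht => h.contraction hν hϑ hq hε hH hκ
      (fun Δ hΔ => hE Δ (le_min hΔ (hcard Δ))) ht)
    (by have := mul_nonneg hν (l2Sq_nonneg γs); positivity) t ht
  have hR : (ν * l2Sq γs + 24 * σ ^ 2 * N) / κ ≤
      ν / κ * l2Sq γs + 48 * (σ ^ 2 / κ * ϑ * (hammingNorm γs : ℝ) *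
        Real.log (Real.exp 1 * (n : ℝ) / (hammingNorm γs : ℝ))) := by
    calc _ ≤ (ν * l2Sq γs + 24 * σ ^ 2 * (2 * N')) / κ := by gcongr
      _ = _ := by rw [hN']; ring
  linarith

/-- A decay of the outlier error transfers to the prediction error, since by `mulVec_sub_eq` the two
differ by `H e` at every time. -/
theorem IsOneLineRun.coefficient_error_le {A B : ℝ} {r : ℝ} (hr0 : 0 ≤ r) (hr1 : r ≤ 1)
    (h : IsOneLineRun X (X *ᵥ βs + γs + e) q ν β γ) {t : ℕ} (ht : 1 ≤ t)
    (hγ : l2Sq (hatMatrix X *ᵥ (γ t - γs)) ≤ r * l2Sq (hatMatrix X *ᵥ (γ 1 - γs)) + A)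
    (hB : l2Sq (hatMatrix X *ᵥ e) ≤ B) :
    l2Sq (X *ᵥ (β t - βs)) ≤ 4 * (r * l2Sq (X *ᵥ (β 1 - βs))) + 2 * A + 6 * B := by
  have h1 : l2Sq (hatMatrix X *ᵥ (γ 1 - γs)) ≤ 2 * l2Sq (X *ᵥ (β 1 - βs)) + 2 * B := by
    have e1 : hatMatrix X *ᵥ (γ 1 - γs) = -(X *ᵥ (β 1 - βs)) + hatMatrix X *ᵥ e := by
      rw [h.mulVec_sub_eq le_rfl]; abel
    have := l2Sq_add_le (-(X *ᵥ (β 1 - βs))) (hatMatrix X *ᵥ e)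
    rw [← e1, l2Sq_neg] at this
    linarith
  have h2 := l2Sq_add_le (-(hatMatrix X *ᵥ (γ t - γs))) (hatMatrix X *ᵥ e)
  rw [← h.mulVec_sub_eq ht, l2Sq_neg] at h2
  have h3 := mul_le_mul_of_nonneg_left h1 hr0
  have hB0 : 0 ≤ B := (l2Sq_nonneg _).trans hB
  nlinarith [mul_le_mul_of_nonneg_right hr1 hB0]

end

theorem le_real_of_compl_le {Ω : Type*} [MeasurableSpace Ω] {P : Measure Ω} [IsProbabilityMeasure P]
    {E : Set Ω} (hE : MeasurableSet E) {δ : ℝ} (h : P.real Eᶜ ≤ δ) : 1 - δ ≤ P.real E := by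
  rw [probReal_compl_eq_one_sub hE] at h
  linarith

theorem theorem2 :
    -- (a) universal sublinear rate
    (∀ (n p q : ℕ) (X : Matrix (Fin n) (Fin p) ℝ) (y : Fin n → ℝ) (ν : ℝ), 0 ≤ ν →
      ∀ (β : ℕ → Fin p → ℝ) (γ : ℕ → Fin n → ℝ),
      (IsBCDRun X y q ν β γ ∨ (IsOneLineRun X y q ν β γ ∧ hammingNorm (γ 1) ≤ q)) →
      ∀ (T : ℕ) (hT : 1 ≤ T),
        (Finset.Icc 1 T).inf' (Finset.nonempty_Icc.mpr hT)
            (fun t => l2Sq (X *ᵥ (β t - β (t + 1)))) =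
          (Finset.Icc 1 T).inf' (Finset.nonempty_Icc.mpr hT)
            (fun t => l2Sq (hatMatrix X *ᵥ (γ t - γ (t + 1)))) ∧
        (Finset.Icc 1 T).inf' (Finset.nonempty_Icc.mpr hT)
            (fun t => l2Sq (hatMatrix X *ᵥ (γ t - γ (t + 1)))) ≤
          1 / (T : ℝ) * (l2Sq ((1 - hatMatrix X) *ᵥ (γ 1 - y)) + ν * l2Sq (γ 1))) ∧
    -- (b) geometric convergence of the statistical error, with numerical constants `K`, `C`, `c`
    ∃ K C c : ℝ, 0 < K ∧ 0 < C ∧ 0 < c ∧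
      ∀ (n p : ℕ), p < n →
      ∀ (X : Matrix (Fin n) (Fin p) ℝ) (βs : Fin p → ℝ) (γs : Fin n → ℝ)
        (q : ℕ) (ϑ ε ν σ : ℝ),
      1 < ϑ → (q : ℝ) = ϑ * (hammingNorm γs : ℝ) →
      0 < ε → ε < 1 → 0 ≤ ν → 0 ≤ σ →
      HatRIP X ε ((1 + ϑ) * (hammingNorm γs : ℝ)) →
      0 < rateKappa ε ϑ ν →
      ∀ (Ω : Type*) [MeasurableSpace Ω] (P : Measure Ω) [IsProbabilityMeasure P]
        (noise : Ω → Fin n → ℝ), Measurable noise →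
        -- error of the outlier iterates under sub-Gaussian noise
        (IsSubGaussianVec P noise σ →
          ∃ E : Set Ω, MeasurableSet E ∧ 1 - C * ((n : ℝ) - (p : ℝ)) ^ (-c) ≤ P.real E ∧
            ∀ ω ∈ E, ∀ (β : ℕ → Fin p → ℝ) (γ : ℕ → Fin n → ℝ),
              (IsBCDRun X (X *ᵥ βs + γs + noise ω) q ν β γ ∨
                IsOneLineRun X (X *ᵥ βs + γs + noise ω) q ν β γ) →
              ∀ t : ℕ, 1 ≤ t →
                l2Sq (hatMatrix X *ᵥ (γ t - γs)) ≤
                  K * ((1 / (1 + rateKappa ε ϑ ν)) ^ (t - 1) * l2Sq (hatMatrix X *ᵥ (γ 1 - γs))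
                    + ν / rateKappa ε ϑ ν * l2Sq γs
                    + σ ^ 2 / rateKappa ε ϑ ν * ϑ * (hammingNorm γs : ℝ) *
                        Real.log (Real.exp 1 * (n : ℝ) / (hammingNorm γs : ℝ)))) ∧
        -- error of the coefficient iterates under independent sub-Gaussian noise
        (IsIndepSubGaussian P noise σ →
          ∃ E : Set Ω, MeasurableSet E ∧
            1 - C * ((n : ℝ) - (p : ℝ)) ^ (-c) - C * Real.exp (-c * (p : ℝ)) ≤ P.real E ∧
            ∀ ω ∈ E, ∀ (β : ℕ → Fin p → ℝ) (γ : ℕ → Fin n → ℝ),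
              (IsBCDRun X (X *ᵥ βs + γs + noise ω) q ν β γ ∨
                IsOneLineRun X (X *ᵥ βs + γs + noise ω) q ν β γ) →
              ∀ t : ℕ, 1 ≤ t →
                l2Sq (X *ᵥ (β t - βs)) ≤
                  K * ((1 / (1 + rateKappa ε ϑ ν)) ^ (t - 1) * l2Sq (X *ᵥ (β 1 - βs))
                    + ν / rateKappa ε ϑ ν * l2Sq γs
                    + (p : ℝ) * σ ^ 2
                    + σ ^ 2 / rateKappa ε ϑ ν * ϑ * (hammingNorm γs : ℝ) *
                        Real.log (Real.exp 1 * (n : ℝ) / (hammingNorm γs : ℝ)))) := by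
  refine ⟨fun n p q X y ν hν β γ h T hT => ?_, 100, 1, 1, by norm_num, one_pos, one_pos, ?_⟩
  · obtain ⟨hrun, hγ⟩ : IsOneLineRun X y q ν β γ ∧ hammingNorm (γ 1) ≤ q :=
      h.elim (fun h => ⟨h.isOneLineRun, (h 0).1.hammingNorm_le⟩) id
    exact ⟨Finset.inf'_congr _ rfl fun t ht => hrun.mulVec_sub (Finset.mem_Icc.1 ht).1,
      hrun.inf_le hν hγ T hT⟩
  intro n p hpn X βs γs q ϑ ε ν σ hϑ hq hε0 hε1 hν hσ hH hκ Ω _ P _ noise hnoise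
  have hn : 0 < n := by omega
  have hnp : (n : ℝ)⁻¹ ≤ 1 * ((n : ℝ) - (p : ℝ)) ^ (-1 : ℝ) := by
    have : (0 : ℝ) < n - p := sub_pos.2 (by exact_mod_cast hpn)
    rw [Real.rpow_neg_one, one_mul]
    exact inv_anti₀ this (by linarith [Nat.cast_nonneg (α := ℝ) p])
  set κ := rateKappa ε ϑ ν with hκdef
  set N := σ ^ 2 / κ * ϑ * (hammingNorm γs : ℝ) *
    Real.log (Real.exp 1 * (n : ℝ) / (hammingNorm γs : ℝ)) with hN
  have hN0 : 0 ≤ N := by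
    rcases Nat.eq_zero_or_pos (hammingNorm γs) with h0 | h0
    · simp [hN, h0]
    · have h1 : hammingNorm γs ≤ n := by simpa using hammingNorm_le_card_fintype (x := γs)
      have h2 := one_le_log_exp_mul_div h0 h1
      positivity
  have hV0 : 0 ≤ ν / κ * l2Sq γs := mul_nonneg (by positivity) (l2Sq_nonneg _)
  have hr0 : ∀ t : ℕ, 0 ≤ (1 / (1 + κ)) ^ (t - 1) := fun t => by positivity
  have hr1 : ∀ t : ℕ, (1 / (1 + κ)) ^ (t - 1) ≤ 1 := fun t =>
    pow_le_one₀ (by positivity) (by rw [div_le_one (by positivity)]; linarith)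
  have hmn : min (hammingNorm γs + q) n ≤ n := min_le_right _ _
  constructor
  · intro hvec
    obtain ⟨E, hEm, hEp, hE⟩ :=
      (hvec.hasMgfBound hσ hnoise).exists_event_sparse hn hσ hnoise (1 - hatMatrix X) hmn
    refine ⟨E, hEm, le_real_of_compl_le hEm (hEp.trans hnp), fun ω hω β γ h t ht => ?_⟩
    have hrun := h.elim IsBCDRun.isOneLineRun id
    have h1 := hrun.outlier_error_le hν hϑ hq hε1 hH hκ (hE ω hω) ht
    have h2 := mul_nonneg (hr0 t) (l2Sq_nonneg (hatMatrix X *ᵥ (γ 1 - γs)))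
    linarith
  · intro hind
    have hmgf := hind.hasMgfBound hσ hnoise
    obtain ⟨E, hEm, hEp, hE⟩ := hmgf.exists_event_sparse hn hσ hnoise (1 - hatMatrix X) hmn
    obtain ⟨F, hFm, hFp, hF⟩ := hmgf.exists_event_range hσ hnoise X (2 * p)
    have hFp' : P.real Fᶜ ≤ 1 * Real.exp (-1 * p) := by
      refine hFp.trans ?_
      rw [Fintype.card_fin, one_mul]
      calc (2 : ℝ) ^ p * Real.exp (-(2 * p)) ≤ Real.exp 1 ^ p * Real.exp (-(2 * p)) := by
            gcongr
            linarith [Real.add_one_le_exp 1]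
        _ = Real.exp (-1 * p) := by
            rw [← Real.exp_nat_mul, ← Real.exp_add]; congr 1; ring
    refine ⟨E ∩ F, hEm.inter hFm, ?_, fun ω hω β γ h t ht => ?_⟩
    · have h1 : P.real (E ∩ F)ᶜ ≤ P.real Eᶜ + P.real Fᶜ := by
        rw [Set.compl_inter]; exact measureReal_union_le _ _
      rw [sub_sub]
      exact le_real_of_compl_le (hEm.inter hFm) (by linarith)
    have hrun := h.elim IsBCDRun.isOneLineRun id
    have h1 := hrun.outlier_error_le hν hϑ hq hε1 hH hκ (hE ω hω.1) ht
    have h2 := hatMatrix_projection_noise_le X (noise ω) (hF ω hω.2)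
    rw [add_assoc] at h1
    have h3 := hrun.coefficient_error_le (hr0 t) (hr1 t) ht h1 h2
    have h4 := mul_nonneg (hr0 t) (l2Sq_nonneg (X *ᵥ (β 1 - βs)))
    have h5 : 0 ≤ (p : ℝ) * σ ^ 2 := by positivity
    linarith
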